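/- Let $c>0$ and let $m_2(dr')=c\,\frac{dr'}{r'^2}$, taken either on $(0,\infty)$ or cut off to $(0,1]$; put $m(ds,dr')=ds\,m_2(dr')$ on $\mathbb R\times\mathbb R_+$. Let $(W(h))_{h\in L^2(m)}$ be an isonormal Gaussian process over $L^2(\mathbb R\times\mathbb R_+,m)$ on a probability space $(\Omega,\mathcal F,\mathbb P)$, that is, a centered Gaussian family with $\mathbb E\,W(h)W(g)=\langle h,g\rangle$. Let $D$ be its Malliavin derivative, the closure in $L^2(\Omega)\times L^2(\Omega\times(\mathbb R\times\mathbb R_+))$ of $g(W(\varphi_1),\dots,W(\varphi_n))\mapsto\sum_i\partial_i g(W(\varphi_1),\dots,W(\varphi_n))\,\varphi_i$ ($g$ smooth with compact support), with domain $\mathbb D^{1,2}$. Let $\delta$ be the divergence: $u\in\mathrm{Dom}(\delta)$ means that $u\in L^2(\Omega\times(\mathbb R\times\mathbb R_+))$ and $|\mathbb E\langle DF,u\rangle|\le C\|F\|_{L^2(\Omega)}$ for all $F\in\mathbb D^{1,2}$ with some constant $C$, and $\delta(u)\in L^2(\Omega,\sigma(W),\mathbb P)$ is characterized by $\mathbb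 E(F\delta(u))=\mathbb E\langle DF,u\rangle$ for all $F\in\mathbb D^{1,2}$. For $r>0$ and $a\in\mathbb R$ let $$C_r(a)=\{(t',r'):\ r\le r'\le 1,\ a-\tfrac{r'}2\le t'\le a+\tfrac{r'}2\},\qquad Q_r(a)=\frac{e^{W(1_{C_r(a)})}}{\mathbb E\,e^{W(1_{C_r(a)})}} .$$ Let $\tfrac12<H<1$ and, for $a>s>0$, $$K(a,s)=c_H s^{1/2-H}\int_s^a (u-s)^{H-3/2}u^{H-1/2}\,du,\qquad c_H=\Big(\frac{H(2H-1)}{\beta(2-2H,H-\frac12)}\Big)^{1/2},$$ where $\beta$ is the Beta function, and let $A_2\subset\mathbb R_+$ be a Borel set with $m_2(A_2)=1$ (which may or may not meet $(0,1)$). Put $W^{(1)}(t)=W(1_{[0,t]\times A_2})$ and $B^H(t)=\int_0^tK(t,s)\,dW^{(1)}(s)$. Then for every $r>0$ and $t\ge 0$: the process $(Q_r(a))_{a\in\mathbb R}$ has a jointly measurable version; for every such version and every $s\in(0,t)$ the integral $\int_s^t\partial_1K(a,s)Q_r(a)\,da$ converges absolutely almost surely, and the process $$u(s,r')=1_{[0,t]}(s)\,1_{A_2}(r')\int_s^t\partial_1K(a,s)\,Q_r(a)\,da$$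 belongs to $\mathrm{Dom}(\delta)$. Hence the Skorohod integral $Z^H_r(t)=\int_0^tQ_r(u)\,dB^H(u)$, which by definition is $\delta(u)$, is well defined: $\delta(u)$ exists, is almost surely unique, and does not depend on the version of $Q_r$. -/

import Mathlib

open MeasureTheory ProbabilityTheory Set

noncomputable section

namespace FracMRW

/-! ### Malliavin calculus of an isonormal process over `L²(T, μ)` -/

section Malliavin

variable {Ω T : Type*} [MeasurableSpace Ω] [MeasurableSpace T]

/-- `W` is an isonormal Gaussian process over the real Hilbert space `L²(T, μ)`: a centered
Gaussian family of random variables with `E[W(h) W(g)] = ⟨h, g⟩`. -/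
structure IsIsonormal (P : Measure Ω) (μ : Measure T) (W : Lp ℝ 2 μ → Ω → ℝ) : Prop where
  measurable : ∀ h, Measurable (W h)
  gaussian : IsGaussianProcess W P
  centered : ∀ h, ∫ ω, W h ω ∂P = 0
  covariance : ∀ h g, ∫ ω, W h ω * W g ω ∂P = inner ℝ h g

/-- The σ-algebra generated by all the random variables `W h`. -/
abbrev noiseSigma {μ : Measure T} (W : Lp ℝ 2 μ → Ω → ℝ) : MeasurableSpace Ω :=
  ⨆ h, MeasurableSpace.comap (W h) inferInstance

/-- The smooth functional `F = g(W(φ₁), …, W(φₙ))`. -/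
def smoothFunctional {μ : Measure T} (W : Lp ℝ 2 μ → Ω → ℝ) {n : ℕ}
    (g : (Fin n → ℝ) → ℝ) (φ : Fin n → Lp ℝ 2 μ) (ω : Ω) : ℝ :=
  g (fun i => W (φ i) ω)

/-- The Malliavin derivative `D F = ∑ᵢ ∂ᵢg(W(φ₁), …, W(φₙ)) φᵢ` of the smooth functional
`F = g(W(φ₁), …, W(φₙ))`, as a function on `Ω × T`. -/
def smoothDerivative {μ : Measure T} (W : Lp ℝ 2 μ → Ω → ℝ) {n : ℕ}
    (g : (Fin n → ℝ) → ℝ) (φ : Fin n → Lp ℝ 2 μ) (z : Ω × T) : ℝ :=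
  ∑ i, fderiv ℝ g (fun j => W (φ j) z.1) (Pi.single i 1) * (φ i : T → ℝ) z.2

/-- The graph of the Malliavin derivative on smooth functionals (`g` smooth with compact
support), in `L²(Ω) × L²(Ω × T)`. -/
def smoothGraph (P : Measure Ω) (μ : Measure T) (W : Lp ℝ 2 μ → Ω → ℝ) :
    Set (Lp ℝ 2 P × Lp ℝ 2 (P.prod μ)) :=
  {p | ∃ (n : ℕ) (g : (Fin n → ℝ) → ℝ) (φ : Fin n → Lp ℝ 2 μ),
    ContDiff ℝ (⊤ : ℕ∞) g ∧ HasCompactSupport g ∧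
    p.1 =ᵐ[P] smoothFunctional W g φ ∧ p.2 =ᵐ[P.prod μ] smoothDerivative W g φ}

/-- The graph of the closed operator `D` with domain `𝔻^{1,2}`: the pairs `(F, D F)`,
`F ∈ 𝔻^{1,2}`, are the limits in `L²(Ω) × L²(Ω × T)` of pairs `(Fₙ, D Fₙ)` with `Fₙ` smooth. -/
def malliavinGraph (P : Measure Ω) (μ : Measure T) (W : Lp ℝ 2 μ → Ω → ℝ) :
    Set (Lp ℝ 2 P × Lp ℝ 2 (P.prod μ)) :=
  closure (smoothGraph P μ W)

/-- `u ∈ Dom(δ)`: `u ∈ L²(Ω × T)` and `|E⟨D F, u⟩| ≤ C ‖F‖_{L²(Ω)}` for all `F ∈ 𝔻^{1,2}`. -/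
def InDomDivergence (P : Measure Ω) (μ : Measure T) (W : Lp ℝ 2 μ → Ω → ℝ)
    (u : Ω × T → ℝ) : Prop :=
  MemLp u 2 (P.prod μ) ∧
    ∃ C : ℝ, ∀ p ∈ malliavinGraph P μ W, |∫ z, p.2 z * u z ∂(P.prod μ)| ≤ C * ‖p.1‖

/-- `Z = δ(u)`: `Z` is the square integrable, `W`-measurable (up to null sets) random variable
with `E[F Z] = E⟨D F, u⟩` for all `F ∈ 𝔻^{1,2}`. -/
structure IsDivergence (P : Measure Ω) (μ : Measure T) (W : Lp ℝ 2 μ → Ω → ℝ)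
    (u : Ω × T → ℝ) (Z : Ω → ℝ) : Prop where
  mem_dom : InDomDivergence P μ W u
  memLp : MemLp Z 2 P
  measurable : AEStronglyMeasurable[noiseSigma W] Z P
  duality : ∀ p ∈ malliavinGraph P μ W,
    ∫ ω, p.1 ω * Z ω ∂P = ∫ z, p.2 z * u z ∂(P.prod μ)

end Malliavin

/-! ### The control measure and the cascading noise -/

/-- The measure `m₂(dr) = c dr / r²` on the set `J ⊆ (0, ∞)` of scales. -/
def scaleMeasure (c : ℝ) (J : Set ℝ) : Measure ℝ :=
  (volume.restrict J).withDensity (fun r => ENNReal.ofReal (c / r ^ 2))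

instance (c : ℝ) (J : Set ℝ) : SFinite (scaleMeasure c J) := by
  unfold scaleMeasure; infer_instance

/-- The control measure `m(dt, dr) = dt c dr / r²`. -/
def controlMeasure (c : ℝ) (J : Set ℝ) : Measure (ℝ × ℝ) :=
  (volume : Measure ℝ).prod (scaleMeasure c J)

instance (c : ℝ) (J : Set ℝ) : SFinite (controlMeasure c J) := by
  unfold controlMeasure; infer_instance

/-- The cone `C_r(t) = {(t', r') : r ≤ r' ≤ 1, t - r'/2 ≤ t' ≤ t + r'/2}`. -/
def cone (r t : ℝ) : Set (ℝ × ℝ) :=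
  {x | r ≤ x.2 ∧ x.2 ≤ 1 ∧ t - x.2 / 2 ≤ x.1 ∧ x.1 ≤ t + x.2 / 2}

theorem measurableSet_cone (r t : ℝ) : MeasurableSet (cone r t) := by
  unfold cone
  measurability

theorem controlMeasure_cone_ne_top {c : ℝ} (hc : 0 < c) (J : Set ℝ) {r : ℝ} (hr : 0 < r) (t : ℝ) :
    controlMeasure c J (cone r t) ≠ ⊤ := by
  have hsub : cone r t ⊆ Icc (t - 1 / 2) (t + 1 / 2) ×ˢ Icc r 1 := by
    rintro ⟨x, y⟩ ⟨h1, h2, h3, h4⟩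
    simp only at h1 h2 h3 h4
    refine ⟨⟨?_, ?_⟩, h1, h2⟩ <;> simp only <;> linarith
  have h2 : scaleMeasure c J (Icc r 1) < ⊤ := by
    rw [scaleMeasure, withDensity_apply _ measurableSet_Icc]
    refine lt_of_le_of_lt (setLIntegral_mono' (g := fun _ => ENNReal.ofReal (c / r ^ 2))
      measurableSet_Icc ?_) ?_
    · intro x hx
      apply ENNReal.ofReal_le_ofReal
      have := hx.1
      gcongr
    · rw [setLIntegral_const]
      refine ENNReal.mul_lt_top ENNReal.ofReal_lt_top ?_
      refine lt_of_le_of_lt (Measure.restrict_apply_le _ _) ?_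
      simp
  refine ((measure_mono hsub).trans_lt ?_).ne
  rw [controlMeasure, Measure.prod_prod]
  exact ENNReal.mul_lt_top (by simp) h2

/-- `W(C_r(t)) = W(1_{C_r(t)})`. -/
def coneNoise {Ω : Type*} {c : ℝ} (hc : 0 < c) {J : Set ℝ}
    (W : Lp ℝ 2 (controlMeasure c J) → Ω → ℝ) {r : ℝ} (hr : 0 < r) (t : ℝ) : Ω → ℝ :=
  W (indicatorConstLp 2 (measurableSet_cone r t) (controlMeasure_cone_ne_top hc J hr t) 1)

/-- The random variable `e^{W(C_r(t))} / E e^{W(C_r(t))}`. -/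
def cascadeValue {Ω : Type*} [MeasurableSpace Ω] (P : Measure Ω) {c : ℝ} (hc : 0 < c) {J : Set ℝ}
    (W : Lp ℝ 2 (controlMeasure c J) → Ω → ℝ) {r : ℝ} (hr : 0 < r) (t : ℝ) (ω : Ω) : ℝ :=
  Real.exp (coneNoise hc W hr t ω) / ∫ ω', Real.exp (coneNoise hc W hr t ω') ∂P

/-- `Q` is a jointly measurable version of the cascading noise `(Q_r(a))_{a ∈ ℝ}`. -/
structure IsCascadeNoise {Ω : Type*} [MeasurableSpace Ω] (P : Measure Ω) {c : ℝ} (hc : 0 < c)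
    {J : Set ℝ} (W : Lp ℝ 2 (controlMeasure c J) → Ω → ℝ) {r : ℝ} (hr : 0 < r)
    (Q : ℝ → Ω → ℝ) : Prop where
  measurable : Measurable (Function.uncurry Q)
  version : ∀ a, Q a =ᵐ[P] cascadeValue P hc W hr a

/-! ### The fractional Brownian motion kernel and the Skorohod integral -/

/-- `c_H = (H (2H - 1) / β(2 - 2H, H - 1/2))^{1/2}`. -/
def fbmConst (H : ℝ) : ℝ :=
  Real.sqrt (H * (2 * H - 1) / ProbabilityTheory.beta (2 - 2 * H) (H - 1 / 2))

/-- The kernel `K(t, s) = c_H s^{1/2-H} ∫_s^t (u - s)^{H-3/2} u^{H-1/2} du` for `t > s`, and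
`K(t, s) = 0` otherwise. -/
def fbmKernel (H t s : ℝ) : ℝ :=
  if s < t then
    fbmConst H * s ^ (1 / 2 - H) * ∫ u in s..t, (u - s) ^ (H - 3 / 2) * u ^ (H - 1 / 2)
  else 0

/-- The partial derivative `∂₁K(a, s)` in the first variable. -/
def fbmKernelDeriv (H a s : ℝ) : ℝ :=
  deriv (fun x => fbmKernel H x s) a

/-- For `0 < s < a`, `∂₁K(a, s) = c_H (s/a)^{1/2-H} (a - s)^{H-3/2}`, a true derivative. -/
theorem hasDerivAt_fbmKernel {H : ℝ} (hH : 1 / 2 < H) {a s : ℝ} (hs : 0 < s) (hsa : s < a) :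
    HasDerivAt (fun x => fbmKernel H x s)
      (fbmConst H * (s / a) ^ (1 / 2 - H) * (a - s) ^ (H - 3 / 2)) a := by
  have ha : 0 < a := hs.trans hsa
  have hint : IntervalIntegrable
      (fun u : ℝ => (u - s) ^ (H - 3 / 2) * u ^ (H - 1 / 2)) volume s a := by
    refine IntervalIntegrable.mul_continuousOn ?_ ?_
    · have h := (intervalIntegral.intervalIntegrable_rpow' (a := 0) (b := a - s)
        (r := H - 3 / 2) (by linarith)).comp_sub_right s
      simpa using h
    · exact ContinuousOn.rpow_const continuousOn_id (fun x _ => Or.inr (by linarith))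
  have hcont : ContinuousAt (fun u : ℝ => (u - s) ^ (H - 3 / 2) * u ^ (H - 1 / 2)) a := by
    refine ContinuousAt.mul (ContinuousAt.rpow_const (by fun_prop) (Or.inl ?_))
      (ContinuousAt.rpow_const (by fun_prop) (Or.inl ha.ne'))
    exact (sub_pos.2 hsa).ne'
  have hmeas : Measurable (fun u : ℝ => (u - s) ^ (H - 3 / 2) * u ^ (H - 1 / 2)) := by
    fun_prop
  have h := (intervalIntegral.integral_hasDerivAt_right hint
    (hmeas.stronglyMeasurable.stronglyMeasurableAtFilter) hcont).const_mul
    (fbmConst H * s ^ (1 / 2 - H))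
  have heq : fbmConst H * s ^ (1 / 2 - H) * ((a - s) ^ (H - 3 / 2) * a ^ (H - 1 / 2))
      = fbmConst H * (s / a) ^ (1 / 2 - H) * (a - s) ^ (H - 3 / 2) := by
    have hinv : a ^ (H - 1 / 2) = (a ^ (1 / 2 - H))⁻¹ := by
      rw [← Real.rpow_neg ha.le, neg_sub]
    rw [Real.div_rpow hs.le ha.le, hinv, div_eq_mul_inv]
    ring
  rw [heq] at h
  refine h.congr_of_eventuallyEq ?_
  filter_upwards [lt_mem_nhds hsa] with x hx
  simp only [fbmKernel, if_pos hx]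

theorem fbmKernelDeriv_eq {H : ℝ} (hH : 1 / 2 < H) {a s : ℝ} (hs : 0 < s) (hsa : s < a) :
    fbmKernelDeriv H a s = fbmConst H * (s / a) ^ (1 / 2 - H) * (a - s) ^ (H - 3 / 2) :=
  (hasDerivAt_fbmKernel hH hs hsa).deriv

/-- The inner integral `∫_s^t ∂₁K(a, s) X(a) da`, as a function of `(ω, s)`. -/
def kernelTransfer {Ω : Type*} (H t : ℝ) (X : ℝ → Ω → ℝ) (ω : Ω) (s : ℝ) : ℝ :=
  ∫ a in s..t, fbmKernelDeriv H a s * X a ω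

/-- The integrand `(s, r') ↦ 1_{[0,t]}(s) 1_{A₂}(r') ∫_s^t ∂₁K(a, s) X(a) da`. -/
def fbmIntegrand {Ω : Type*} (H : ℝ) (A₂ : Set ℝ) (t : ℝ) (X : ℝ → Ω → ℝ)
    (z : Ω × (ℝ × ℝ)) : ℝ :=
  (Icc 0 t).indicator 1 z.2.1 * A₂.indicator 1 z.2.2 * kernelTransfer H t X z.1 z.2.1

/-- `Z = ∫_0^t X(u) dB^H(u)` in the Skorohod sense, where `B^H(t) = ∫_0^t K(t, s) dW⁽¹⁾(s)` and
`W⁽¹⁾(t) = W(1_{[0,t] × A₂})`, for `H > 1/2`.  By definition this is the divergence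
`∫_0^t (∫_s^t ∂₁K(a, s) X(a) da) dW⁽¹⁾(s)`, and `dW⁽¹⁾(s) = ∫_{A₂} dW(s, r')`. -/
def IsFBMSkorohodIntegral {Ω : Type*} [MeasurableSpace Ω] (P : Measure Ω) {c : ℝ} {J : Set ℝ}
    (W : Lp ℝ 2 (controlMeasure c J) → Ω → ℝ) (A₂ : Set ℝ) (H t : ℝ) (X : ℝ → Ω → ℝ)
    (Z : Ω → ℝ) : Prop :=
  IsDivergence P (controlMeasure c J) W (fbmIntegrand H A₂ t X) Z

end FracMRW

end

open FracMRW

noncomputable section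

namespace FracMRW

/-! ### Exponential functionals of an isonormal process -/

section Gaussian

variable {Ω T : Type*} [MeasurableSpace Ω] [MeasurableSpace T] {P : Measure Ω} {μ : Measure T}
  {W : Lp ℝ 2 μ → Ω → ℝ}

namespace IsIsonormal

theorem hasGaussianLaw (hW : IsIsonormal P μ W) (h : Lp ℝ 2 μ) : HasGaussianLaw (W h) P :=
  hW.gaussian.hasGaussianLaw_eval h

theorem memLp_two (hW : IsIsonormal P μ W) (h : Lp ℝ 2 μ) : MemLp (W h) 2 P :=
  (hW.hasGaussianLaw h).memLp_two

theorem integrable_mul (hW : IsIsonormal P μ W) (h g : Lp ℝ 2 μ) :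
    Integrable (fun ω => W h ω * W g ω) P :=
  (hW.memLp_two h).integrable_mul (hW.memLp_two g)

theorem map_eq [IsProbabilityMeasure P] (hW : IsIsonormal P μ W) (h : Lp ℝ 2 μ) :
    P.map (W h) = gaussianReal 0 (‖h‖ ^ 2).toNNReal := by
  rw [(hW.hasGaussianLaw h).map_eq_gaussianReal, hW.centered, variance_eq_sub (hW.memLp_two h),
    hW.centered, ← real_inner_self_eq_norm_sq, ← hW.covariance]
  simp [sq]

theorem add_smul [IsProbabilityMeasure P] (hW : IsIsonormal P μ W) (h g : Lp ℝ 2 μ) (s : ℝ) :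
    W (h + s • g) =ᵐ[P] fun ω => W h ω + s * W g ω := by
  have hsq : ∫ ω, (W (h + s • g) ω - W h ω - s * W g ω) ^ 2 ∂P = 0 := by
    have e : ∀ ω, (W (h + s • g) ω - W h ω - s * W g ω) ^ 2
        = W (h + s • g) ω * W (h + s • g) ω + W h ω * W h ω + s ^ 2 * (W g ω * W g ω)
          - 2 * (W (h + s • g) ω * W h ω) - 2 * s * (W (h + s • g) ω * W g ω)
          + 2 * s * (W h ω * W g ω) := fun ω => by ring
    simp_rw [e]
    have I := hW.integrable_mul
    rw [integral_add (by fun_prop) (by fun_prop), integral_sub (by fun_prop) (by fun_prop),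
      integral_sub (by fun_prop) (by fun_prop), integral_add (by fun_prop) (by fun_prop),
      integral_add (by fun_prop) (by fun_prop)]
    simp_rw [integral_const_mul, hW.covariance]
    simp only [inner_add_left, inner_add_right, real_inner_smul_left, real_inner_smul_right,
      real_inner_comm h g]
    ring
  rw [integral_eq_zero_iff_of_nonneg (fun ω => sq_nonneg _)] at hsq
  · filter_upwards [hsq] with ω hω
    have := pow_eq_zero_iff (two_ne_zero) |>.1 hω
    linarith
  · exact (((hW.memLp_two _).sub (hW.memLp_two _)).sub ((hW.memLp_two g).const_mul s)).integrable_sq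

theorem zero [IsProbabilityMeasure P] (hW : IsIsonormal P μ W) : W 0 =ᵐ[P] 0 := by
  filter_upwards [hW.add_smul 0 0 1] with ω hω
  simp at hω
  simpa using hω

theorem sum_smul [IsProbabilityMeasure P] (hW : IsIsonormal P μ W) {ι : Type*} (I : Finset ι)
    (φ : ι → Lp ℝ 2 μ) (x : ι → ℝ) :
    W (∑ i ∈ I, x i • φ i) =ᵐ[P] fun ω => ∑ i ∈ I, x i * W (φ i) ω := by
  classical
  induction I using Finset.induction_on with
  | empty => simp only [Finset.sum_empty]; exact hW.zero
  | insert a I ha ih =>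
    simp_rw [Finset.sum_insert ha]
    rw [add_comm]
    filter_upwards [ih, hW.add_smul (∑ i ∈ I, x i • φ i) (φ a) (x a)] with ω h1 h2
    rw [h2, h1, add_comm]

theorem mgf_eq [IsProbabilityMeasure P] (hW : IsIsonormal P μ W) (h : Lp ℝ 2 μ) (s : ℝ) :
    mgf (W h) P s = Real.exp (‖h‖ ^ 2 * s ^ 2 / 2) := by
  rw [mgf_gaussianReal (hW.map_eq h)]
  simp

theorem integrable_exp_mul [IsProbabilityMeasure P] (hW : IsIsonormal P μ W) (h : Lp ℝ 2 μ)
    (s : ℝ) : Integrable (fun ω => Real.exp (s * W h ω)) P := by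
  rw [← mgf_pos_iff, hW.mgf_eq]
  exact Real.exp_pos _

theorem integrable_exp [IsProbabilityMeasure P] (hW : IsIsonormal P μ W) (h : Lp ℝ 2 μ) :
    Integrable (fun ω => Real.exp (W h ω)) P := by
  simpa using hW.integrable_exp_mul h 1

theorem integral_exp [IsProbabilityMeasure P] (hW : IsIsonormal P μ W) (h : Lp ℝ 2 μ) :
    ∫ ω, Real.exp (W h ω) ∂P = Real.exp (‖h‖ ^ 2 / 2) := by
  simpa [mgf] using hW.mgf_eq h 1

theorem map_tilted_real [IsProbabilityMeasure P] (hW : IsIsonormal P μ W) (c ψ : Lp ℝ 2 μ) :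
    (P.tilted (W c)).map (W ψ) = P.map (fun ω => W ψ ω + inner ℝ c ψ) := by
  have := isProbabilityMeasure_tilted (hW.integrable_exp c)
  have hψ := hW.measurable ψ
  have hmgf : mgf (W ψ) (P.tilted (W c)) = mgf (fun ω => W ψ ω + inner ℝ c ψ) P := by
    ext s
    have h1 : mgf (W ψ) (P.tilted (W c)) s
        = Real.exp (‖c + s • ψ‖ ^ 2 / 2) / Real.exp (‖c‖ ^ 2 / 2) := by
      rw [mgf, integral_exp_tilted, hW.integral_exp c, ← hW.integral_exp (c + s • ψ)]
      congr 1
      refine integral_congr_ae ?_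
      filter_upwards [hW.add_smul c ψ s] with ω hω
      simp [hω]
    have h2 : mgf (fun ω => W ψ ω + inner ℝ c ψ) P s
        = Real.exp (‖ψ‖ ^ 2 * s ^ 2 / 2) * Real.exp (s * inner ℝ c ψ) := by
      rw [← hW.mgf_eq, mgf, mgf, ← integral_mul_const]
      simp_rw [← Real.exp_add, mul_add]
    rw [h1, h2, ← Real.exp_sub, ← Real.exp_add, norm_add_sq_real, norm_smul, real_inner_smul_right,
      mul_pow, Real.norm_eq_abs, sq_abs]
    congr 1
    ring
  refine Measure.ext_of_complexMGF_eq (by fun_prop) (by fun_prop) ?_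
  have huniv : integrableExpSet (W ψ) (P.tilted (W c)) = univ := by
    ext s
    simp only [integrableExpSet, mem_ofPred_eq, mem_univ, iff_true]
    rw [← mgf_pos_iff, hmgf, mgf]
    simp_rw [mul_add, Real.exp_add]
    rw [integral_mul_const]
    have := hW.mgf_eq ψ s
    rw [mgf] at this
    rw [this]
    positivity
  ext z
  have := eqOn_complexMGF_of_mgf hmgf
  rw [huniv] at this
  exact this (by simp)

/-- **Cameron–Martin formula**: under the tilted measure `e^{W(c)} / E e^{W(c)} dP`, the vector
`(W(φᵢ))ᵢ` has the law of `(W(φᵢ) + ⟨c, φᵢ⟩)ᵢ` under `P`. -/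
theorem map_tilted [IsProbabilityMeasure P] (hW : IsIsonormal P μ W) {ι : Type*} [Fintype ι]
    (c : Lp ℝ 2 μ) (φ : ι → Lp ℝ 2 μ) :
    (P.tilted (W c)).map (fun ω i => W (φ i) ω)
      = P.map (fun ω i => W (φ i) ω + inner ℝ c (φ i)) := by
  classical
  have := isProbabilityMeasure_tilted (hW.integrable_exp c)
  have hφ := fun i => hW.measurable (φ i)
  have := Measure.isProbabilityMeasure_map (μ := P.tilted (W c))
    (f := fun ω i => W (φ i) ω) (by fun_prop)
  have := Measure.isProbabilityMeasure_map (μ := P)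
    (f := fun ω i => W (φ i) ω + inner ℝ c (φ i)) (by fun_prop)
  refine Measure.ext_of_charFunDual ?_
  ext L
  rw [charFunDual_eq_charFun_map_one, charFunDual_eq_charFun_map_one,
    Measure.map_map (by fun_prop) (by fun_prop), Measure.map_map (by fun_prop) (by fun_prop)]
  set ψ : Lp ℝ 2 μ := ∑ i, L (Pi.single i 1) • φ i with hψ
  have hL : ∀ x : ι → ℝ, L x = ∑ i, L (Pi.single i 1) * x i := by
    intro x
    conv_lhs => rw [pi_eq_sum_univ' x, map_sum]
    refine Finset.sum_congr rfl fun i _ => ?_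
    rw [map_smul, smul_eq_mul, mul_comm]
  have hae : W ψ =ᵐ[P] fun ω => L (fun i => W (φ i) ω) := by
    filter_upwards [hW.sum_smul Finset.univ φ (fun i => L (Pi.single i 1))] with ω hω
    rw [hψ, hω, hL]
  have h1 : (P.tilted (W c)).map (L ∘ fun ω i => W (φ i) ω) = (P.tilted (W c)).map (W ψ) :=
    Measure.map_congr ((tilted_absolutelyContinuous P (W c)).ae_le hae.symm)
  have h2 : P.map (L ∘ fun ω i => W (φ i) ω + inner ℝ c (φ i))
      = P.map (fun ω => W ψ ω + inner ℝ c ψ) := by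
    refine Measure.map_congr ?_
    filter_upwards [hae] with ω hω
    rw [hω, hψ, inner_sum]
    simp only [Function.comp, real_inner_smul_right]
    rw [hL, hL, ← Finset.sum_add_distrib]
    exact Finset.sum_congr rfl fun i _ => by ring
  rw [h1, h2, hW.map_tilted_real]

end IsIsonormal

/-- The normalized exponential `e^{W(c)} / E e^{W(c)}`. -/
def wickExp (P : Measure Ω) (W : Lp ℝ 2 μ → Ω → ℝ) (c : Lp ℝ 2 μ) (ω : Ω) : ℝ :=
  Real.exp (W c ω) / ∫ ω', Real.exp (W c ω') ∂P

namespace IsIsonormal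

@[fun_prop]
theorem measurable_wickExp (hW : IsIsonormal P μ W) (c : Lp ℝ 2 μ) :
    Measurable (wickExp P W c) :=
  ((hW.measurable c).exp).div_const _

variable [IsProbabilityMeasure P]

theorem wickExp_pos (hW : IsIsonormal P μ W) (c : Lp ℝ 2 μ) (ω : Ω) : 0 < wickExp P W c ω := by
  rw [wickExp, hW.integral_exp]
  positivity

theorem wickExp_eq (hW : IsIsonormal P μ W) (c : Lp ℝ 2 μ) (ω : Ω) :
    wickExp P W c ω = Real.exp (W c ω - ‖c‖ ^ 2 / 2) := by
  rw [wickExp, hW.integral_exp, Real.exp_sub]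

theorem wickExp_add_smul (hW : IsIsonormal P μ W) (c h : Lp ℝ 2 μ) (s : ℝ) :
    wickExp P W (c + s • h) =ᵐ[P] fun ω => wickExp P W c ω
      * Real.exp (s * W h ω - s * inner ℝ c h - s ^ 2 * ‖h‖ ^ 2 / 2) := by
  filter_upwards [hW.add_smul c h s] with ω hω
  rw [hW.wickExp_eq, hW.wickExp_eq, hω, ← Real.exp_add, norm_add_sq_real, norm_smul,
      real_inner_smul_right, mul_pow, Real.norm_eq_abs, sq_abs]
  congr 1
  ring

theorem wickExp_mul (hW : IsIsonormal P μ W) (c d : Lp ℝ 2 μ) :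
    (fun ω => wickExp P W c ω * wickExp P W d ω) =ᵐ[P]
      fun ω => Real.exp (inner ℝ c d) * wickExp P W (c + d) ω := by
  have := hW.wickExp_add_smul c d 1
  rw [one_smul] at this
  filter_upwards [this] with ω hω
  rw [hω, hW.wickExp_eq d, mul_left_comm, ← Real.exp_add]
  congr 2
  ring

theorem integral_wickExp_mul (hW : IsIsonormal P μ W) {ι : Type*} [Fintype ι] (c : Lp ℝ 2 μ)
    (φ : ι → Lp ℝ 2 μ) {f : (ι → ℝ) → ℝ} (hf : Measurable f) :
    ∫ ω, wickExp P W c ω * f (fun i => W (φ i) ω) ∂P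
      = ∫ ω, f (fun i => W (φ i) ω + inner ℝ c (φ i)) ∂P := by
  have hφ := fun i => hW.measurable (φ i)
  have h := integral_tilted (μ := P) (W c) (fun ω => f (fun i => W (φ i) ω))
  simp only [smul_eq_mul] at h
  simp only [wickExp]
  rw [← h, ← integral_map (φ := fun ω i => W (φ i) ω) (by fun_prop)
    hf.aestronglyMeasurable, hW.map_tilted, integral_map (by fun_prop) hf.aestronglyMeasurable]

theorem integrable_wickExp_mul (hW : IsIsonormal P μ W) {ι : Type*} [Fintype ι] (c : Lp ℝ 2 μ)
    (φ : ι → Lp ℝ 2 μ) {f : (ι → ℝ) → ℝ} (hf : Measurable f)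
    (hi : Integrable (fun ω => f (fun i => W (φ i) ω + inner ℝ c (φ i))) P) :
    Integrable (fun ω => wickExp P W c ω * f (fun i => W (φ i) ω)) P := by
  have hφ := fun i => hW.measurable (φ i)
  have h1 : Integrable f (P.map (fun ω i => W (φ i) ω + inner ℝ c (φ i))) := by
    rw [integrable_map_measure hf.aestronglyMeasurable (by fun_prop)]
    exact hi
  rw [← hW.map_tilted, integrable_map_measure hf.aestronglyMeasurable (by fun_prop),
    integrable_tilted_iff (hW.integrable_exp c)] at h1
  simpa [wickExp, div_mul_eq_mul_div] using h1.div_const (∫ ω', Real.exp (W c ω') ∂P)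

theorem integral_wickExp (hW : IsIsonormal P μ W) (c : Lp ℝ 2 μ) :
    ∫ ω, wickExp P W c ω ∂P = 1 := by
  have h := hW.integral_wickExp_mul c (fun _ : Fin 0 => 0) (f := fun _ => 1) (by fun_prop)
  simpa using h

theorem integrable_wickExp (hW : IsIsonormal P μ W) (c : Lp ℝ 2 μ) :
    Integrable (wickExp P W c) P :=
  (hW.integrable_exp c).div_const _

theorem integrable_wickExp_mul_wickExp (hW : IsIsonormal P μ W) (c d : Lp ℝ 2 μ) :
    Integrable (fun ω => wickExp P W c ω * wickExp P W d ω) P :=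
  ((hW.integrable_wickExp (c + d)).const_mul _).congr (hW.wickExp_mul c d).symm

theorem integral_wickExp_mul_wickExp (hW : IsIsonormal P μ W) (c d : Lp ℝ 2 μ) :
    ∫ ω, wickExp P W c ω * wickExp P W d ω ∂P = Real.exp (inner ℝ c d) := by
  rw [integral_congr_ae (hW.wickExp_mul c d), integral_const_mul, hW.integral_wickExp, mul_one]

theorem memLp_wickExp (hW : IsIsonormal P μ W) (c : Lp ℝ 2 μ) : MemLp (wickExp P W c) 2 P := by
  rw [memLp_two_iff_integrable_sq (hW.measurable_wickExp c).aestronglyMeasurable]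
  simpa [sq] using hW.integrable_wickExp_mul_wickExp c c

theorem integral_wickExp_sub_sq_le (hW : IsIsonormal P μ W) {c d : Lp ℝ 2 μ} {V δ : ℝ}
    (hδ : 0 ≤ δ) (hcV : ‖c‖ ^ 2 ≤ V) (hdV : ‖d‖ ^ 2 ≤ V) (hc : ‖c‖ ^ 2 - inner ℝ c d ≤ δ)
    (hd : ‖d‖ ^ 2 - inner ℝ c d ≤ δ) :
    ∫ ω, (wickExp P W c ω - wickExp P W d ω) ^ 2 ∂P ≤ 2 * Real.exp V * δ := by
  have e : ∀ ω, (wickExp P W c ω - wickExp P W d ω) ^ 2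
      = wickExp P W c ω * wickExp P W c ω + wickExp P W d ω * wickExp P W d ω
        - 2 * (wickExp P W c ω * wickExp P W d ω) := fun ω => by ring
  have I := hW.integrable_wickExp_mul_wickExp
  simp_rw [e]
  rw [integral_sub (by fun_prop) (by fun_prop), integral_add (by fun_prop) (by fun_prop),
    integral_const_mul]
  simp_rw [hW.integral_wickExp_mul_wickExp, real_inner_self_eq_norm_sq]
  have key : ∀ x y : ℝ, y ≤ V → y - x ≤ δ → Real.exp y - Real.exp x ≤ Real.exp V * δ := by
    intro x y hy hyx
    have h1 : Real.exp y - Real.exp x = Real.exp y * (1 - Real.exp (x - y)) := by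
      rw [mul_sub, ← Real.exp_add]; simp
    rw [h1]
    calc _ ≤ Real.exp y * δ := mul_le_mul_of_nonneg_left
          (by linarith [Real.add_one_le_exp (x - y)]) (Real.exp_pos _).le
      _ ≤ _ := mul_le_mul_of_nonneg_right (Real.exp_le_exp.2 hy) hδ
  linarith [key _ _ hcV hc, key _ _ hdV hd]

end IsIsonormal

end Gaussian

/-! ### Integration by parts and the divergence of simple exponential integrands -/

section IntegrationByParts

variable {Ω T : Type*} [MeasurableSpace Ω] [MeasurableSpace T] {P : Measure Ω} {μ : Measure T}
  {W : Lp ℝ 2 μ → Ω → ℝ}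

/-- The Skorohod integral of the simple integrand `wickExp c ⊗ h`. -/
def wickTerm (P : Measure Ω) (W : Lp ℝ 2 μ → Ω → ℝ) (c h : Lp ℝ 2 μ) (ω : Ω) : ℝ :=
  wickExp P W c ω * (W h ω - inner ℝ c h)

namespace IsIsonormal

variable [IsProbabilityMeasure P]

theorem hasDerivAt_integral_exp_mul (hW : IsIsonormal P μ W) (h : Lp ℝ 2 μ) {G : Ω → ℝ}
    (hG : Measurable G) {M : ℝ} (hM : ∀ ω, |G ω| ≤ M) :
    HasDerivAt (fun ε : ℝ => ∫ ω, Real.exp (ε * W h ω - ε ^ 2 * ‖h‖ ^ 2 / 2) * G ω ∂P)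
      (∫ ω, W h ω * G ω ∂P) 0 := by
  have hh := hW.measurable h
  have hM0 : 0 ≤ M := by
    obtain ⟨ω⟩ := nonempty_of_isProbabilityMeasure P
    exact (abs_nonneg _).trans (hM ω)
  set S : Ω → ℝ := fun ω => Real.exp (W h ω) + Real.exp (-W h ω) with hS
  have hS2 : Integrable (fun ω => (S ω + ‖h‖ ^ 2) * S ω * M) P := by
    have e : ∀ ω, (S ω + ‖h‖ ^ 2) * S ω * M = M * (Real.exp (2 * W h ω) + Real.exp (-2 * W h ω) + 2)
        + ‖h‖ ^ 2 * M * (Real.exp (1 * W h ω) + Real.exp (-1 * W h ω)) := by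
      intro ω
      have e1 : Real.exp (2 * W h ω) = Real.exp (W h ω) * Real.exp (W h ω) := by
        rw [← Real.exp_add]; ring_nf
      have e2 : Real.exp (-2 * W h ω) = Real.exp (-W h ω) * Real.exp (-W h ω) := by
        rw [← Real.exp_add]; ring_nf
      have e3 : Real.exp (W h ω) * Real.exp (-W h ω) = 1 := by
        rw [← Real.exp_add]; simp
      rw [e1, e2, one_mul, neg_one_mul, hS]
      linear_combination 2 * M * e3
    simp_rw [e]
    have I := hW.integrable_exp_mul h
    exact ((((I 2).add (I (-2))).add (integrable_const _)).const_mul _).add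
      (((I 1).add (I (-1))).const_mul _)
  have hd := hasDerivAt_integral_of_dominated_loc_of_deriv_le (μ := P) (x₀ := (0 : ℝ))
    (s := Ioo (-1) 1)
    (F := fun ε ω => Real.exp (ε * W h ω - ε ^ 2 * ‖h‖ ^ 2 / 2) * G ω)
    (F' := fun ε ω => (W h ω - ε * ‖h‖ ^ 2) * Real.exp (ε * W h ω - ε ^ 2 * ‖h‖ ^ 2 / 2) * G ω)
    (bound := fun ω => (S ω + ‖h‖ ^ 2) * S ω * M)
    (Ioo_mem_nhds (by norm_num) (by norm_num))
    (Filter.Eventually.of_forall fun ε => by fun_prop)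
    ?_ (by fun_prop) ?_ hS2 ?_
  · simpa using hd.2
  · simp only [zero_mul, ne_eq, OfNat.ofNat_ne_zero, not_false_eq_true, zero_pow, zero_div,
      sub_zero, Real.exp_zero, one_mul]
    exact Integrable.of_bound hG.aestronglyMeasurable M (Filter.Eventually.of_forall hM)
  · refine Filter.Eventually.of_forall fun ω ε hε => ?_
    have hε1 : |ε| ≤ 1 := abs_le.2 ⟨hε.1.le, hε.2.le⟩
    have h1 : |W h ω| ≤ S ω := by
      rw [hS]
      rcases abs_cases (W h ω) with ⟨h1, -⟩ | ⟨h1, -⟩ <;> rw [h1]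
      · linarith [Real.add_one_le_exp (W h ω), Real.exp_pos (-W h ω)]
      · linarith [Real.add_one_le_exp (-W h ω), Real.exp_pos (W h ω)]
    have h2 : |W h ω - ε * ‖h‖ ^ 2| ≤ S ω + ‖h‖ ^ 2 := by
      refine (abs_sub _ _).trans ?_
      rw [abs_mul, abs_of_nonneg (sq_nonneg ‖h‖)]
      have := mul_le_mul_of_nonneg_right hε1 (sq_nonneg ‖h‖)
      linarith
    have h3 : Real.exp (ε * W h ω - ε ^ 2 * ‖h‖ ^ 2 / 2) ≤ S ω := by
      have h4 : Real.exp (ε * W h ω - ε ^ 2 * ‖h‖ ^ 2 / 2) ≤ Real.exp |W h ω| := by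
        apply Real.exp_le_exp.2
        have h5 : ε * W h ω ≤ |W h ω| := by
          refine (le_abs_self _).trans ?_
          rw [abs_mul]
          exact mul_le_of_le_one_left (abs_nonneg _) hε1
        have : 0 ≤ ε ^ 2 * ‖h‖ ^ 2 / 2 := by positivity
        linarith
      refine h4.trans ?_
      rw [hS]
      rcases abs_cases (W h ω) with ⟨h1, -⟩ | ⟨h1, -⟩ <;> rw [h1]
      · linarith [Real.exp_pos (-W h ω)]
      · linarith [Real.exp_pos (W h ω)]
    rw [Real.norm_eq_abs, abs_mul, abs_mul, Real.abs_exp]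
    have hS0 : 0 ≤ S ω := (abs_nonneg _).trans h1
    exact mul_le_mul (mul_le_mul h2 h3 (Real.exp_pos _).le (by positivity)) (hM ω) (abs_nonneg _)
      (by positivity)
  · refine Filter.Eventually.of_forall fun ω ε _ => ?_
    have h1 : HasDerivAt (fun ε : ℝ => ε * W h ω - ε ^ 2 * ‖h‖ ^ 2 / 2)
        (W h ω - ε * ‖h‖ ^ 2) ε := by
      have h2 := ((hasDerivAt_id ε).mul_const (W h ω)).sub
        ((((hasDerivAt_id ε).pow 2).mul_const (‖h‖ ^ 2)).div_const 2)
      refine h2.congr_deriv ?_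
      simp
      ring
    refine (h1.exp.mul_const (G ω)).congr_deriv ?_
    ring

theorem integral_mul_eq_integral_fderiv (hW : IsIsonormal P μ W) (h : Lp ℝ 2 μ) {ι : Type*}
    [Fintype ι] (φ : ι → Lp ℝ 2 μ) {g : (ι → ℝ) → ℝ} (hg : ContDiff ℝ 1 g)
    (hgc : HasCompactSupport g) :
    ∫ ω, W h ω * g (fun i => W (φ i) ω) ∂P
      = ∫ ω, fderiv ℝ g (fun i => W (φ i) ω) (fun i => inner ℝ h (φ i)) ∂P := by
  have hφ := fun i => hW.measurable (φ i)
  have hgcont := hg.continuous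
  have hfcont : Continuous (fderiv ℝ g) := hg.continuous_fderiv one_ne_zero
  obtain ⟨M, hM⟩ := hgcont.bounded_above_of_compact_support hgc
  obtain ⟨M', hM'⟩ := hfcont.bounded_above_of_compact_support (hgc.fderiv (𝕜 := ℝ))
  set v : ι → ℝ := fun i => inner ℝ h (φ i) with hv
  have hB : HasDerivAt (fun ε : ℝ => ∫ ω, g (fun i => W (φ i) ω + ε * v i) ∂P)
      (∫ ω, fderiv ℝ g (fun i => W (φ i) ω) v ∂P) 0 := by
    have hd := hasDerivAt_integral_of_dominated_loc_of_deriv_le (μ := P) (x₀ := (0 : ℝ))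
      (s := univ)
      (F := fun ε ω => g (fun i => W (φ i) ω + ε * v i))
      (F' := fun ε ω => fderiv ℝ g (fun i => W (φ i) ω + ε * v i) v)
      (bound := fun ω => M' * ‖v‖)
      Filter.univ_mem
      (Filter.Eventually.of_forall fun ε => ?_)
      ?_ ?_ ?_ (integrable_const _) ?_
    · simpa using hd.2
    · exact (hgcont.measurable.comp (by fun_prop)).aestronglyMeasurable
    · refine Integrable.of_bound (C := M)
        (hgcont.measurable.comp (by fun_prop)).aestronglyMeasurable
        (Filter.Eventually.of_forall fun ω => hM _)
    · refine Measurable.aestronglyMeasurable ?_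
      exact ((hfcont.clm_apply continuous_const).measurable.comp (by fun_prop))
    · refine Filter.Eventually.of_forall fun ω ε _ => ?_
      exact ((fderiv ℝ g _).le_opNorm v).trans (mul_le_mul_of_nonneg_right (hM' _) (norm_nonneg _))
    · refine Filter.Eventually.of_forall fun ω ε _ => ?_
      have h1 : HasDerivAt (fun ε : ℝ => fun i => W (φ i) ω + ε * v i) v ε := by
        rw [hasDerivAt_pi]
        intro i
        simpa using ((hasDerivAt_id ε).mul_const (v i)).const_add (W (φ i) ω)
      exact ((hg.differentiable one_ne_zero) _).hasFDerivAt.comp_hasDerivAt ε h1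
  have hA := hW.hasDerivAt_integral_exp_mul h (G := fun ω => g (fun i => W (φ i) ω))
    (hgcont.measurable.comp (by fun_prop)) (fun ω => hM _)
  refine hA.unique (hB.congr_of_eventuallyEq (Filter.Eventually.of_forall fun ε => ?_))
  have h1 := hW.integral_wickExp_mul (ε • h) φ hgcont.measurable
  simp only [real_inner_smul_left] at h1
  simp only [hv]
  rw [← h1]
  refine integral_congr_ae ?_
  filter_upwards [hW.add_smul 0 h ε, hW.zero] with ω hω h0
  rw [zero_add, h0] at hω
  rw [hW.wickExp_eq, hω, norm_smul, mul_pow, Real.norm_eq_abs, sq_abs]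
  simp

theorem integral_mul_wickTerm (hW : IsIsonormal P μ W) (c h : Lp ℝ 2 μ) {ι : Type*}
    [Fintype ι] (φ : ι → Lp ℝ 2 μ) {g : (ι → ℝ) → ℝ} (hg : ContDiff ℝ 1 g)
    (hgc : HasCompactSupport g) :
    ∫ ω, g (fun i => W (φ i) ω) * wickTerm P W c h ω ∂P
      = ∫ ω, wickExp P W c ω * fderiv ℝ g (fun i => W (φ i) ω) (fun i => inner ℝ h (φ i)) ∂P := by
  have hgcont := hg.continuous
  have hfcont : Continuous (fderiv ℝ g) := hg.continuous_fderiv one_ne_zero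
  set y : ι → ℝ := fun i => inner ℝ c (φ i) with hy
  have h1 := hW.integral_wickExp_mul c (fun o : Option ι => o.elim h φ)
    (f := fun x => g (fun i => x (some i)) * (x none - inner ℝ c h))
    (by
      refine Measurable.mul (hgcont.measurable.comp (by fun_prop)) (by fun_prop))
  have h2 := hW.integral_wickExp_mul c φ (f := fun x => fderiv ℝ g x (fun i => inner ℝ h (φ i)))
    (hfcont.clm_apply continuous_const).measurable
  rw [h2]
  simp only [Option.elim, add_sub_cancel_right] at h1
  have h3 := hW.integral_mul_eq_integral_fderiv h φ (g := fun x => g (x + y))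
    (hg.comp (contDiff_id.add contDiff_const))
    (hgc.comp_homeomorph (Homeomorph.addRight y))
  simp only [fderiv_comp_add_right] at h3
  calc _ = ∫ ω, wickExp P W c ω * (g (fun i => W (φ i) ω) * (W h ω - inner ℝ c h)) ∂P := by
        refine integral_congr_ae (Filter.Eventually.of_forall fun ω => ?_)
        simp only [wickTerm]; ring
    _ = _ := h1
    _ = ∫ ω, W h ω * g ((fun i => W (φ i) ω) + y) ∂P := by
        refine integral_congr_ae (Filter.Eventually.of_forall fun ω => ?_)
        simp only []
        rw [mul_comm]; rfl
    _ = _ := h3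

theorem wickTerm_mul_ae (hW : IsIsonormal P μ W) (c d h g : Lp ℝ 2 μ) :
    (fun ω => wickTerm P W c h ω * wickTerm P W d g ω) =ᵐ[P] fun ω => Real.exp (inner ℝ c d) *
      (wickExp P W (c + d) ω * ((W h ω - inner ℝ c h) * (W g ω - inner ℝ d g))) := by
  filter_upwards [hW.wickExp_mul c d] with ω hω
  rw [← mul_assoc (Real.exp _), ← hω, wickTerm, wickTerm]
  ring

theorem integrable_wickTerm_mul (hW : IsIsonormal P μ W) (c d h g : Lp ℝ 2 μ) :
    Integrable (fun ω => wickTerm P W c h ω * wickTerm P W d g ω) P := by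
  refine Integrable.congr ?_ (hW.wickTerm_mul_ae c d h g).symm
  refine Integrable.const_mul ?_ _
  refine hW.integrable_wickExp_mul (c + d) ![h, g]
    (f := fun x => (x 0 - inner ℝ c h) * (x 1 - inner ℝ d g)) (by fun_prop) ?_
  refine MemLp.integrable_mul (p := 2) (q := 2) ?_ ?_
  · exact ((hW.memLp_two _).add (memLp_const _)).sub (memLp_const _)
  · exact ((hW.memLp_two _).add (memLp_const _)).sub (memLp_const _)

theorem integral_wickTerm_mul (hW : IsIsonormal P μ W) (c d h g : Lp ℝ 2 μ) :
    ∫ ω, wickTerm P W c h ω * wickTerm P W d g ω ∂P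
      = Real.exp (inner ℝ c d) * (inner ℝ h g + inner ℝ d h * inner ℝ c g) := by
  rw [integral_congr_ae (hW.wickTerm_mul_ae c d h g), integral_const_mul]
  congr 1
  have h1 := hW.integral_wickExp_mul (c + d) ![h, g]
    (f := fun x => (x 0 - inner ℝ c h) * (x 1 - inner ℝ d g)) (by fun_prop)
  simp only [Matrix.cons_val_zero, Matrix.cons_val_one, inner_add_left] at h1
  rw [h1]
  have e : ∀ ω, (W h ω + (inner ℝ c h + inner ℝ d h) - inner ℝ c h)
      * (W g ω + (inner ℝ c g + inner ℝ d g) - inner ℝ d g)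
      = W h ω * W g ω + inner ℝ c g * W h ω + inner ℝ d h * W g ω
        + inner ℝ d h * inner ℝ c g := fun ω => by ring
  simp_rw [e]
  have I1 := hW.integrable_mul h g
  have I2 := (hW.hasGaussianLaw h).integrable
  have I3 := (hW.hasGaussianLaw g).integrable
  rw [integral_add (by fun_prop) (by fun_prop), integral_add (by fun_prop) (by fun_prop),
    integral_add (by fun_prop) (by fun_prop), integral_const_mul, integral_const_mul,
    hW.covariance, hW.centered, hW.centered]
  simp

omit [IsProbabilityMeasure P] in
theorem measurable_wickTerm (hW : IsIsonormal P μ W) (c h : Lp ℝ 2 μ) :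
    Measurable (wickTerm P W c h) :=
  (hW.measurable_wickExp c).mul ((hW.measurable h).sub_const _)

theorem memLp_wickTerm (hW : IsIsonormal P μ W) (c h : Lp ℝ 2 μ) :
    MemLp (wickTerm P W c h) 2 P := by
  rw [memLp_two_iff_integrable_sq (hW.measurable_wickTerm c h).aestronglyMeasurable]
  simpa [sq] using hW.integrable_wickTerm_mul c c h h

end IsIsonormal

end IntegrationByParts

/-! ### The divergence: duality, uniqueness and an existence criterion -/

section Divergence

open Filter Topology

variable {Ω T : Type*} [MeasurableSpace Ω] [MeasurableSpace T] {P : Measure Ω} {μ : Measure T}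
  {W : Lp ℝ 2 μ → Ω → ℝ}

theorem inner_toLp {X : Type*} [MeasurableSpace X] {ν : Measure X} (f : Lp ℝ 2 ν) {g : X → ℝ}
    (hg : MemLp g 2 ν) : inner ℝ f (hg.toLp g) = ∫ z, f z * g z ∂ν := by
  rw [L2.inner_def]
  refine integral_congr_ae ?_
  filter_upwards [hg.coeFn_toLp] with z hz
  rw [hz]
  simp [mul_comm]

theorem inner_Lp {X : Type*} [MeasurableSpace X] {ν : Measure X} (f g : Lp ℝ 2 ν) :
    inner ℝ f g = ∫ z, f z * g z ∂ν := by
  rw [L2.inner_def]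
  simp [mul_comm]

theorem integrable_mul_of_memLp_two {X : Type*} [MeasurableSpace X] {ν : Measure X} {f g : X → ℝ}
    (hf : MemLp f 2 ν) (hg : MemLp g 2 ν) : Integrable (fun x => f x * g x) ν :=
  hf.integrable_mul hg

theorem duality_of_smoothGraph {Z : Ω → ℝ} {u : Ω × T → ℝ} (hZ : MemLp Z 2 P)
    (hu : MemLp u 2 (P.prod μ))
    (h : ∀ p ∈ smoothGraph P μ W, ∫ ω, p.1 ω * Z ω ∂P = ∫ z, p.2 z * u z ∂(P.prod μ)) :
    ∀ p ∈ malliavinGraph P μ W, ∫ ω, p.1 ω * Z ω ∂P = ∫ z, p.2 z * u z ∂(P.prod μ) := by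
  have hcl : IsClosed {p : Lp ℝ 2 P × Lp ℝ 2 (P.prod μ) |
      inner ℝ p.1 (hZ.toLp Z) = inner ℝ p.2 (hu.toLp u)} :=
    isClosed_eq (by fun_prop) (by fun_prop)
  intro p hp
  have := closure_minimal (s := smoothGraph P μ W) (fun q hq => ?_) hcl hp
  · simpa only [mem_ofPred_eq, inner_toLp] using this
  · simpa only [mem_ofPred_eq, inner_toLp] using h q hq

theorem exists_weak_limit {E : Type*} [NormedAddCommGroup E] [InnerProductSpace ℝ E]
    [CompleteSpace E] {x : ℕ → E} {C : ℝ} (hx : ∀ n, ‖x n‖ ≤ C) :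
    ∃ (y : E) (U : Ultrafilter ℕ), (U : Filter ℕ) ≤ atTop ∧
      ∀ v, Tendsto (fun n => inner ℝ (x n) v) U (𝓝 (inner ℝ y v)) := by
  set D : ℕ → WeakDual ℝ E := fun n =>
    StrongDual.toWeakDual (InnerProductSpace.toDual ℝ E (x n)) with hD
  have hcomp := WeakDual.isCompact_closedBall (𝕜 := ℝ) (E := E) 0 C
  obtain ⟨y, -, hy⟩ := hcomp.ultrafilter_le_nhds ((hyperfilter ℕ).map D) (by
    rw [le_principal_iff, Ultrafilter.mem_coe, Ultrafilter.mem_map]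
    refine Filter.univ_mem' fun n => ?_
    simp only [mem_preimage, Metric.mem_closedBall, dist_zero_right, hD]
    exact ((InnerProductSpace.toDual ℝ E).norm_map (x n)).le.trans (hx n))
  refine ⟨(InnerProductSpace.toDual ℝ E).symm (WeakDual.toStrongDual y), hyperfilter ℕ,
    Nat.hyperfilter_le_atTop, fun v => ?_⟩
  rw [InnerProductSpace.toDual_symm_apply]
  have h1 : Tendsto D (hyperfilter ℕ) (𝓝 y) := hy
  exact ((WeakDual.eval_continuous v).tendsto y).comp h1

theorem IsIsonormal.noiseSigma_le (hW : IsIsonormal P μ W) :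
    noiseSigma W ≤ (inferInstance : MeasurableSpace Ω) :=
  iSup_le fun h => (hW.measurable h).comap_le

theorem exists_isDivergence_of_tendsto (hW : IsIsonormal P μ W) {u : Ω × T → ℝ}
    {v : ℕ → Ω × T → ℝ} {Y : ℕ → Ω → ℝ} (hu : MemLp u 2 (P.prod μ))
    (hv : ∀ n, MemLp (v n) 2 (P.prod μ)) (hY : ∀ n, MemLp (Y n) 2 P)
    (hYm : ∀ n, AEStronglyMeasurable[noiseSigma W] (Y n) P) {C : ℝ}
    (hC : ∀ n, ∫ ω, Y n ω ^ 2 ∂P ≤ C)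
    (hdual : ∀ n, ∀ p ∈ malliavinGraph P μ W,
      ∫ ω, p.1 ω * Y n ω ∂P = ∫ z, p.2 z * v n z ∂(P.prod μ))
    (hlim : Tendsto (fun n => eLpNorm (v n - u) 2 (P.prod μ)) atTop (𝓝 0)) :
    ∃ Z, IsDivergence P μ W u Z := by
  have : Fact (noiseSigma W ≤ (inferInstance : MeasurableSpace Ω)) := ⟨hW.noiseSigma_le⟩
  set K := lpMeas ℝ ℝ (noiseSigma W) 2 P with hK
  have hYK : ∀ n, (hY n).toLp (Y n) ∈ K := fun n => by
    rw [hK, mem_lpMeas_iff_aestronglyMeasurable]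
    exact (hYm n).congr (hY n).coeFn_toLp.symm
  have hnorm : ∀ n, ‖(hY n).toLp (Y n)‖ ≤ √C := fun n => by
    refine Real.le_sqrt_of_sq_le ?_
    rw [← real_inner_self_eq_norm_sq, inner_toLp]
    refine le_trans (le_of_eq ?_) (hC n)
    refine integral_congr_ae ?_
    filter_upwards [(hY n).coeFn_toLp] with ω hω
    rw [hω, sq]
  obtain ⟨Z, U, hU, hZ⟩ := exists_weak_limit hnorm
  have hZK : Z ∈ K := by
    rw [← K.orthogonal_orthogonal, Submodule.mem_orthogonal']
    intro w hw
    refine tendsto_nhds_unique (hZ w) ?_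
    have : ∀ n, inner ℝ ((hY n).toLp (Y n)) w = 0 := fun n =>
      (Submodule.mem_orthogonal _ _).1 hw _ (hYK n)
    simp_rw [this]
    exact tendsto_const_nhds
  have hd : ∀ p ∈ malliavinGraph P μ W,
      ∫ ω, p.1 ω * Z ω ∂P = ∫ z, p.2 z * u z ∂(P.prod μ) := by
    intro p hp
    have h1 := hZ p.1
    have h2 : Tendsto (fun n => inner ℝ p.2 ((hv n).toLp (v n))) U
        (𝓝 (inner ℝ p.2 (hu.toLp u))) := by
      have := (Lp.tendsto_Lp_iff_tendsto_eLpNorm'' v hv u hu).2 hlim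
      exact (tendsto_const_nhds.inner this).mono_left hU
    have h3 : ∀ n, inner ℝ ((hY n).toLp (Y n)) p.1 = inner ℝ p.2 ((hv n).toLp (v n)) := by
      intro n
      rw [real_inner_comm, inner_toLp, inner_toLp, hdual n p hp]
    simp_rw [h3] at h1
    have h4 := tendsto_nhds_unique h1 h2
    rwa [inner_toLp, real_inner_comm, inner_Lp] at h4
  refine ⟨Z, ⟨hu, ‖Z‖, fun p hp => ?_⟩, Lp.memLp Z, ?_, hd⟩
  · rw [← hd p hp, ← inner_Lp, real_inner_comm]
    exact abs_real_inner_le_norm _ _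
  · rwa [hK, mem_lpMeas_iff_aestronglyMeasurable] at hZK

theorem IsDivergence.congr {u u' : Ω × T → ℝ} {Z Z' : Ω → ℝ} (h : IsDivergence P μ W u Z)
    (hu : u =ᵐ[P.prod μ] u') (hZ : Z =ᵐ[P] Z') : IsDivergence P μ W u' Z' := by
  have e : ∀ p : Lp ℝ 2 P × Lp ℝ 2 (P.prod μ),
      ∫ z, p.2 z * u z ∂(P.prod μ) = ∫ z, p.2 z * u' z ∂(P.prod μ) := fun p =>
    integral_congr_ae (by filter_upwards [hu] with z hz; rw [hz])
  have e' : ∀ p : Lp ℝ 2 P × Lp ℝ 2 (P.prod μ),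
      ∫ ω, p.1 ω * Z ω ∂P = ∫ ω, p.1 ω * Z' ω ∂P := fun p =>
    integral_congr_ae (by filter_upwards [hZ] with z hz; rw [hz])
  obtain ⟨⟨h1, C, h2⟩, h3, h4, h5⟩ := h
  exact ⟨⟨h1.ae_eq hu, C, fun p hp => by rw [← e]; exact h2 p hp⟩, h3.ae_eq hZ, h4.congr hZ,
    fun p hp => by rw [← e, ← e']; exact h5 p hp⟩

section Uniqueness

variable [IsProbabilityMeasure P]

theorem IsIsonormal.memLp_smoothFunctional (hW : IsIsonormal P μ W) {n : ℕ}
    {g : (Fin n → ℝ) → ℝ} (hg : Continuous g) (hgc : HasCompactSupport g)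
    (φ : Fin n → Lp ℝ 2 μ) (q : ENNReal) : MemLp (smoothFunctional W g φ) q P := by
  have hφ := fun i => hW.measurable (φ i)
  obtain ⟨M, hM⟩ := hg.bounded_above_of_compact_support hgc
  exact MemLp.of_bound (hg.measurable.comp (by fun_prop)).aestronglyMeasurable M
    (Eventually.of_forall fun ω => hM _)

omit [IsProbabilityMeasure P] in
theorem memLp_mul_prod [SFinite μ] {f : Ω → ℝ} {g : T → ℝ} (hf : MemLp f 2 P)
    (hg : MemLp g 2 μ) : MemLp (fun z : Ω × T => f z.1 * g z.2) 2 (P.prod μ) := by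
  have hm : AEStronglyMeasurable (fun z : Ω × T => f z.1 * g z.2) (P.prod μ) :=
    hf.aestronglyMeasurable.comp_fst.mul hg.aestronglyMeasurable.comp_snd
  rw [memLp_two_iff_integrable_sq hm]
  simp_rw [mul_pow]
  exact hf.integrable_sq.mul_prod hg.integrable_sq

theorem IsIsonormal.memLp_smoothDerivative [SFinite μ] (hW : IsIsonormal P μ W) {n : ℕ}
    {g : (Fin n → ℝ) → ℝ} (hg : ContDiff ℝ 1 g) (hgc : HasCompactSupport g)
    (φ : Fin n → Lp ℝ 2 μ) : MemLp (smoothDerivative W g φ) 2 (P.prod μ) := by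
  refine memLp_finsetSum _ fun i _ => memLp_mul_prod
    (f := fun ω => fderiv ℝ g (fun j => W (φ j) ω) (Pi.single i 1)) ?_ (Lp.memLp (φ i))
  exact hW.memLp_smoothFunctional
    (g := fun x => fderiv ℝ g x (Pi.single i 1))
    ((hg.continuous_fderiv one_ne_zero).clm_apply continuous_const)
    ((hgc.fderiv (𝕜 := ℝ)).mono (fun x hx h => hx (by simp [h]))) φ 2

theorem measure_eq_of_integral_contDiff_eq {E : Type*} [NormedAddCommGroup E] [NormedSpace ℝ E]
    [FiniteDimensional ℝ E] [MeasurableSpace E] [BorelSpace E] {ν₁ ν₂ : Measure E}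
    [IsFiniteMeasure ν₁] [IsFiniteMeasure ν₂]
    (h : ∀ g : E → ℝ, ContDiff ℝ (⊤ : ℕ∞) g → HasCompactSupport g →
      ∫ x, g x ∂ν₁ = ∫ x, g x ∂ν₂) : ν₁ = ν₂ := by
  set ν := ν₁ + ν₂ with hν
  have h1 : ν₁ ≪ ν := Measure.AbsolutelyContinuous.rfl.add_right _
  have h2 : ν₂ ≪ ν := by rw [hν, add_comm]; exact Measure.AbsolutelyContinuous.rfl.add_right _
  have hae : ∀ᵐ x ∂ν, (ν₁.rnDeriv ν x).toReal = (ν₂.rnDeriv ν x).toReal := by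
    refine ae_eq_of_integral_contDiff_smul_eq Measure.integrable_toReal_rnDeriv.locallyIntegrable
      Measure.integrable_toReal_rnDeriv.locallyIntegrable fun g hg hgc => ?_
    have := h g hg hgc
    rw [← integral_rnDeriv_smul h1, ← integral_rnDeriv_smul h2] at this
    simpa [mul_comm] using this
  rw [← Measure.withDensity_rnDeriv_eq _ _ h1, ← Measure.withDensity_rnDeriv_eq _ _ h2]
  refine withDensity_congr_ae ?_
  filter_upwards [hae, ν₁.rnDeriv_lt_top ν, ν₂.rnDeriv_lt_top ν] with x hx h1 h2
  rwa [ENNReal.toReal_eq_toReal_iff' h1.ne h2.ne] at hx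

/-- Smooth functionals separate the points of `L¹(Ω, σ(W))`. -/
theorem IsIsonormal.ae_eq_zero_of_integral_smooth (hW : IsIsonormal P μ W) {X : Ω → ℝ}
    (hX : Integrable X P) (hXm : AEStronglyMeasurable[noiseSigma W] X P)
    (h : ∀ (n : ℕ) (g : (Fin n → ℝ) → ℝ) (φ : Fin n → Lp ℝ 2 μ), ContDiff ℝ (⊤ : ℕ∞) g →
      HasCompactSupport g → ∫ ω, smoothFunctional W g φ ω * X ω ∂P = 0) :
    X =ᵐ[P] 0 := by
  wlog hXmeas : Measurable X generalizing X
  · have h1 := hX.aestronglyMeasurable.ae_eq_mk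
    refine h1.trans (this (hX.congr h1) (hXm.congr h1) (fun n g φ hg hgc => ?_)
      hX.aestronglyMeasurable.stronglyMeasurable_mk.measurable)
    rw [← h n g φ hg hgc]
    refine integral_congr_ae ?_
    filter_upwards [h1] with ω hω
    rw [hω]
  have hmeas := hW.measurable
  set ν₁ := P.withDensity (fun ω => ENNReal.ofReal (X ω)) with hν₁
  set ν₂ := P.withDensity (fun ω => ENNReal.ofReal (-X ω)) with hν₂
  have : IsFiniteMeasure ν₁ := isFiniteMeasure_withDensity_ofReal hX.2
  have : IsFiniteMeasure ν₂ := isFiniteMeasure_withDensity_ofReal hX.neg.2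
  have hint : ∀ {G : Ω → ℝ}, Measurable G → (∃ M, ∀ ω, ‖G ω‖ ≤ M) →
      ∫ ω, G ω ∂ν₁ - ∫ ω, G ω ∂ν₂ = ∫ ω, G ω * X ω ∂P := by
    rintro G hG ⟨M, hM⟩
    rw [hν₁, hν₂, integral_withDensity_eq_integral_toReal_smul (by fun_prop) (by simp),
      integral_withDensity_eq_integral_toReal_smul (by fun_prop) (by simp), ← integral_sub]
    · refine integral_congr_ae (Eventually.of_forall fun ω => ?_)
      simp only [smul_eq_mul, ENNReal.toReal_ofReal']
      rw [← sub_mul, mul_comm]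
      congr 1
      rcases le_total 0 (X ω) with h0 | h0
      · rw [max_eq_left h0, max_eq_right (by linarith), sub_zero]
      · rw [max_eq_right h0, max_eq_left (by linarith), zero_sub, neg_neg]
    · simp only [ENNReal.toReal_ofReal', smul_eq_mul]
      exact hX.pos_part.mul_bdd hG.aestronglyMeasurable (Eventually.of_forall hM)
    · simp only [ENNReal.toReal_ofReal', smul_eq_mul]
      exact hX.neg.pos_part.mul_bdd hG.aestronglyMeasurable (Eventually.of_forall hM)
  set Φ : Ω → Lp ℝ 2 μ → ℝ := fun ω h => W h ω with hΦ
  have hΦm : Measurable Φ := by fun_prop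
  have hfin : ∀ I : Finset (Lp ℝ 2 μ),
      (ν₁.map Φ).map I.restrict = (ν₂.map Φ).map I.restrict := by
    intro I
    rw [Measure.map_map (by fun_prop) hΦm, Measure.map_map (by fun_prop) hΦm]
    refine measure_eq_of_integral_contDiff_eq fun g hg hgc => ?_
    rw [integral_map (by fun_prop) hg.continuous.aestronglyMeasurable,
      integral_map (by fun_prop) hg.continuous.aestronglyMeasurable, ← sub_eq_zero]
    obtain ⟨M, hM⟩ := hg.continuous.bounded_above_of_compact_support hgc
    rw [hint (G := fun ω => g ((I.restrict ∘ Φ) ω))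
      (hg.continuous.measurable.comp (by fun_prop)) ⟨M, fun ω => hM _⟩]
    let L : (Fin I.card → ℝ) ≃L[ℝ] (I → ℝ) :=
      (LinearEquiv.funCongrLeft ℝ ℝ I.equivFin).toContinuousLinearEquiv
    rw [← h I.card (g ∘ L) (fun i => (I.equivFin.symm i : Lp ℝ 2 μ)) (hg.comp L.contDiff)
      (hgc.comp_homeomorph L.toHomeomorph)]
    refine integral_congr_ae (Eventually.of_forall fun ω => ?_)
    simp only [smoothFunctional, Function.comp]
    congr 2
    ext i
    simp [L, hΦ, LinearEquiv.funCongrLeft]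
  have hmap : ν₁.map Φ = ν₂.map Φ := by
    refine IsProjectiveLimit.unique (P := fun I => (ν₂.map Φ).map I.restrict) hfin fun I => rfl
  refine ae_eq_of_forall_setIntegral_eq_of_sigmaFinite' hW.noiseSigma_le
    (fun s _ _ => hX.integrableOn) (fun s _ _ => integrableOn_zero) (fun s hs _ => ?_) hXm
    aestronglyMeasurable_zero
  have hs' : MeasurableSet s := hW.noiseSigma_le s hs
  have hcomap : noiseSigma W = MeasurableSpace.comap Φ MeasurableSpace.pi := by
    rw [noiseSigma, MeasurableSpace.pi, MeasurableSpace.comap_iSup]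
    simp_rw [MeasurableSpace.comap_comp]
    rfl
  rw [hcomap] at hs
  obtain ⟨B, hB, rfl⟩ := hs
  have h1 : ν₁ (Φ ⁻¹' B) = ν₂ (Φ ⁻¹' B) := by
    rw [← Measure.map_apply hΦm hB, hmap, Measure.map_apply hΦm hB]
  have h2 := hint (G := (Φ ⁻¹' B).indicator 1) (measurable_one.indicator hs')
    ⟨1, fun ω => (norm_indicator_le_norm_self _ _).trans (by simp)⟩
  rw [integral_indicator_one hs', integral_indicator_one hs', measureReal_def, measureReal_def, h1,
    sub_self] at h2
  rw [← integral_indicator hs']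
  simp only [Pi.zero_apply, integral_zero]
  rw [h2]
  refine integral_congr_ae (Eventually.of_forall fun ω => ?_)
  by_cases hω : ω ∈ Φ ⁻¹' B <;> simp [hω]

theorem IsDivergence.ae_eq [SFinite μ] (hW : IsIsonormal P μ W) {u : Ω × T → ℝ} {Z Z' : Ω → ℝ}
    (h : IsDivergence P μ W u Z) (h' : IsDivergence P μ W u Z') : Z =ᵐ[P] Z' := by
  have hi := (h.memLp.sub h'.memLp)
  have := hW.ae_eq_zero_of_integral_smooth (hi.integrable one_le_two)
    (h.measurable.sub h'.measurable) fun n g φ hg hgc => ?_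
  · filter_upwards [this] with ω hω
    simpa [sub_eq_zero] using hω
  · have hF := hW.memLp_smoothFunctional hg.continuous hgc φ 2
    have hD := hW.memLp_smoothDerivative (hg.of_le (by exact_mod_cast le_top)) hgc φ
    have hp : (hF.toLp _, hD.toLp _) ∈ malliavinGraph P μ W :=
      subset_closure ⟨n, g, φ, hg, hgc, hF.coeFn_toLp, hD.coeFn_toLp⟩
    have e := (h.duality _ hp).trans (h'.duality _ hp).symm
    simp only [Pi.sub_apply, mul_sub]
    rw [integral_sub (integrable_mul_of_memLp_two hF h.memLp)
      (integrable_mul_of_memLp_two hF h'.memLp), sub_eq_zero]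
    have e' : ∀ Y : Ω → ℝ, ∫ ω, hF.toLp _ ω * Y ω ∂P = ∫ ω, smoothFunctional W g φ ω * Y ω ∂P :=
      fun Y => integral_congr_ae (by filter_upwards [hF.coeFn_toLp] with ω hω; rw [hω])
    rw [← e', ← e']
    exact e

/-- The divergence of the simple integrand `∑ᵢ wickExp cᵢ ⊗ hᵢ`. -/
theorem IsIsonormal.duality_wickTerm [SFinite μ] (hW : IsIsonormal P μ W) {ι : Type*}
    (I : Finset ι) (c h : ι → Lp ℝ 2 μ) :
    ∀ p ∈ malliavinGraph P μ W, ∫ ω, p.1 ω * (∑ i ∈ I, wickTerm P W (c i) (h i) ω) ∂P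
      = ∫ z, p.2 z * (∑ i ∈ I, wickExp P W (c i) z.1 * h i z.2) ∂(P.prod μ) := by
  refine duality_of_smoothGraph (memLp_finsetSum _ fun i _ => hW.memLp_wickTerm (c i) (h i))
    (memLp_finsetSum _ fun i _ => memLp_mul_prod (hW.memLp_wickExp _) (Lp.memLp _)) ?_
  rintro p ⟨n, g, φ, hg, hgc, h1, h2⟩
  have hg1 : ContDiff ℝ 1 g := hg.of_le (by exact_mod_cast le_top)
  simp_rw [Finset.mul_sum]
  rw [integral_finsetSum _ fun i _ => integrable_mul_of_memLp_two (Lp.memLp p.1) (hW.memLp_wickTerm _ _),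
    integral_finsetSum _ fun i _ => integrable_mul_of_memLp_two (Lp.memLp p.2)
      (memLp_mul_prod (hW.memLp_wickExp _) (Lp.memLp _))]
  refine Finset.sum_congr rfl fun i _ => ?_
  have e1 : ∫ ω, p.1 ω * wickTerm P W (c i) (h i) ω ∂P
      = ∫ ω, g (fun i => W (φ i) ω) * wickTerm P W (c i) (h i) ω ∂P := by
    refine integral_congr_ae ?_
    filter_upwards [h1] with ω hω
    rw [hω]; rfl
  have e2 : ∫ z, p.2 z * (wickExp P W (c i) z.1 * h i z.2) ∂(P.prod μ)
      = ∫ z, ∑ j, (wickExp P W (c i) z.1 * fderiv ℝ g (fun j => W (φ j) z.1) (Pi.single j 1))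
        * (h i z.2 * φ j z.2) ∂(P.prod μ) := by
    refine integral_congr_ae ?_
    filter_upwards [h2] with z hz
    rw [hz, smoothDerivative, Finset.sum_mul]
    exact Finset.sum_congr rfl fun j _ => by ring
  have hi : ∀ j, Integrable (fun ω => wickExp P W (c i) ω
      * fderiv ℝ g (fun j => W (φ j) ω) (Pi.single j 1)) P := fun j => by
    refine integrable_mul_of_memLp_two (hW.memLp_wickExp _) ?_
    exact hW.memLp_smoothFunctional
      (g := fun x => fderiv ℝ g x (Pi.single j 1))
      ((hg1.continuous_fderiv one_ne_zero).clm_apply continuous_const)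
      ((hgc.fderiv (𝕜 := ℝ)).mono (fun x hx h => hx (by simp [h]))) φ 2
  rw [e1, e2, hW.integral_mul_wickTerm _ _ φ hg1 hgc, integral_finsetSum _ fun j _ =>
    (hi j).mul_prod (integrable_mul_of_memLp_two (Lp.memLp (h i)) (Lp.memLp (φ j)))]
  have e3 : ∀ ω, wickExp P W (c i) ω * fderiv ℝ g (fun j => W (φ j) ω)
      (fun j => inner ℝ (h i) (φ j))
      = ∑ j, wickExp P W (c i) ω * fderiv ℝ g (fun j => W (φ j) ω) (Pi.single j 1)
        * inner ℝ (h i) (φ j) := by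
    intro ω
    conv_lhs => rw [pi_eq_sum_univ' (fun j => inner ℝ (h i) (φ j)), map_sum, Finset.mul_sum]
    refine Finset.sum_congr rfl fun j _ => ?_
    rw [map_smul, smul_eq_mul]
    ring
  simp_rw [e3]
  rw [integral_finsetSum _ fun j _ => (hi j).mul_const _]
  refine Finset.sum_congr rfl fun j _ => ?_
  rw [integral_mul_const, integral_prod_mul (fun ω => wickExp P W (c i) ω
      * fderiv ℝ g (fun j => W (φ j) ω) (Pi.single j 1)) (fun x => h i x * φ j x), inner_Lp]

end Uniqueness

end Divergence

/-! ### Kernel integrals of normalized exponentials -/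

section Kernel

open Filter Topology

theorem lintegral_mul_sq_le {X : Type*} [MeasurableSpace X] (ν : Measure X) {f g : X → ENNReal}
    (hf : AEMeasurable f ν) (hg : AEMeasurable g ν) :
    (∫⁻ x, f x * g x ∂ν) ^ 2 ≤ (∫⁻ x, f x ∂ν) * ∫⁻ x, f x * g x ^ 2 ∂ν := by
  have h := ENNReal.lintegral_mul_le_Lp_mul_Lq ν Real.HolderConjugate.two_two
    (f := fun x => f x ^ (1 / 2 : ℝ)) (g := fun x => f x ^ (1 / 2 : ℝ) * g x)
    (hf.pow_const _) ((hf.pow_const _).mul hg)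
  have e1 : ∀ x, f x ^ (1 / 2 : ℝ) * (f x ^ (1 / 2 : ℝ) * g x) = f x * g x := fun x => by
    rw [← mul_assoc, ← ENNReal.rpow_add_of_nonneg _ _ (by norm_num) (by norm_num)]
    norm_num
  have e2 : ∀ x, (f x ^ (1 / 2 : ℝ)) ^ (2 : ℝ) = f x := fun x => by
    rw [← ENNReal.rpow_mul]; norm_num
  have e3 : ∀ x, (f x ^ (1 / 2 : ℝ) * g x) ^ (2 : ℝ) = f x * g x ^ 2 := fun x => by
    rw [ENNReal.mul_rpow_of_nonneg _ _ (by norm_num), e2, ENNReal.rpow_two]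
  simp only [Pi.mul_apply, e1, e2, e3] at h
  calc _ ≤ ((∫⁻ x, f x ∂ν) ^ (1 / 2 : ℝ) * (∫⁻ x, f x * g x ^ 2 ∂ν) ^ (1 / 2 : ℝ)) ^ 2 := by
        gcongr
    _ = _ := by
      rw [mul_pow, ← ENNReal.rpow_two, ← ENNReal.rpow_two, ← ENNReal.rpow_mul, ← ENNReal.rpow_mul]
      norm_num

theorem eLpNorm_two_sq {X : Type*} [MeasurableSpace X] (ν : Measure X) (f : X → ℝ) :
    eLpNorm f 2 ν ^ 2 = ∫⁻ x, ‖f x‖ₑ ^ 2 ∂ν := by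
  simpa using eLpNorm_nnreal_pow_eq_lintegral (f := f) (μ := ν) (p := 2) two_ne_zero

variable {Ω T : Type*} [MeasurableSpace Ω] [MeasurableSpace T] {P : Measure Ω} {μ : Measure T}
  {W : Lp ℝ 2 μ → Ω → ℝ}

/-- A nonnegative kernel `k(a, x)`, supported in `a ∈ [0, L)`, whose integral in `a` belongs to
`L¹(μ) ∩ L²(μ)`. -/
structure IsKernel (μ : Measure T) (L : ℕ) (k : ℝ → T → ℝ) : Prop where
  measurable : Measurable (Function.uncurry k)
  nonneg : ∀ a x, 0 ≤ k a x
  support : ∀ a x, a ∉ Ico (0 : ℝ) L → k a x = 0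
  integrable : ∀ x, Integrable (fun a => k a x)
  integrable_integral : Integrable (fun x => ∫ a, k a x) μ
  memLp_integral : MemLp (fun x => ∫ a, k a x) 2 μ

/-- A Lipschitz family of `[0, 1]`-valued functions in `L²(μ)`. -/
structure IsField (c : ℝ → Lp ℝ 2 μ) (V M : ℝ) : Prop where
  nonneg : ∀ a, ∀ᵐ x ∂μ, 0 ≤ c a x
  le_one : ∀ a, ∀ᵐ x ∂μ, c a x ≤ 1
  norm_sq_le : ∀ a, ‖c a‖ ^ 2 ≤ V
  sub_inner_le : ∀ a b, ‖c a‖ ^ 2 - inner ℝ (c a) (c b) ≤ M * |a - b|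

theorem IsField.nonneg_lipschitz {c : ℝ → Lp ℝ 2 μ} {V M : ℝ} (hc : IsField c V M) : 0 ≤ M := by
  have h1 := hc.sub_inner_le 0 1
  have h2 := hc.sub_inner_le 1 0
  have h3 := norm_sub_sq_real (c 0) (c 1)
  rw [real_inner_comm] at h2
  norm_num at h1 h2
  nlinarith [sq_nonneg ‖c 0 - c 1‖]

namespace IsKernel

variable {L : ℕ} {k : ℝ → T → ℝ}

theorem lintegral_eq (hk : IsKernel μ L k) (x : T) :
    ∫⁻ a, ENNReal.ofReal (k a x) = ENNReal.ofReal (∫ a, k a x) :=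
  (ofReal_integral_eq_lintegral_ofReal (hk.integrable x)
    (Eventually.of_forall fun a => hk.nonneg a x)).symm

theorem stronglyMeasurable_integral_mul (hk : IsKernel μ L k) {X : ℝ → Ω → ℝ}
    (hX : Measurable (Function.uncurry X)) :
    StronglyMeasurable (fun z : Ω × T => ∫ a, k a z.2 * X a z.1) := by
  have h1 : Measurable (fun q : (Ω × T) × ℝ => k q.2 q.1.2 * X q.2 q.1.1) :=
    (hk.measurable.comp (by fun_prop : Measurable fun q : (Ω × T) × ℝ => (q.2, q.1.2))).mul
      (hX.comp (by fun_prop : Measurable fun q : (Ω × T) × ℝ => (q.2, q.1.1)))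
  exact h1.stronglyMeasurable.integral_prod_right

theorem stronglyMeasurable_setIntegral (hk : IsKernel μ L k) (A : Set ℝ) :
    StronglyMeasurable (fun x => ∫ a in A, k a x) := by
  have h : Measurable (Function.uncurry fun (x : T) (a : ℝ) => k a x) :=
    hk.measurable.comp measurable_swap
  exact h.stronglyMeasurable.integral_prod_right

theorem lintegral_integral_mul_sq_le [SFinite P] [SFinite μ] (hk : IsKernel μ L k)
    {X : ℝ → Ω → ℝ} (hX : Measurable (Function.uncurry X)) {δ : ENNReal}
    (hδ : ∀ a, ∫⁻ ω, ‖X a ω‖ₑ ^ 2 ∂P ≤ δ) :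
    ∫⁻ z, ‖∫ a, k a z.2 * X a z.1‖ₑ ^ 2 ∂(P.prod μ)
      ≤ δ * ∫⁻ x, ‖∫ a, k a x‖ₑ ^ 2 ∂μ := by
  have hXm : ∀ ω, Measurable fun a => X a ω := fun ω => hX.comp (by fun_prop : Measurable
    fun a : ℝ => (a, ω))
  have hkm : ∀ x, Measurable fun a => k a x := fun x => hk.measurable.comp (by fun_prop :
    Measurable fun a : ℝ => (a, x))
  have hpt : ∀ ω x, ‖∫ a, k a x * X a ω‖ₑ ^ 2
      ≤ ENNReal.ofReal (∫ a, k a x) * ∫⁻ a, ENNReal.ofReal (k a x) * ‖X a ω‖ₑ ^ 2 := by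
    intro ω x
    rw [← hk.lintegral_eq]
    refine le_trans ?_ (lintegral_mul_sq_le volume (hkm x).ennreal_ofReal.aemeasurable
      (hXm ω).enorm.aemeasurable)
    gcongr
    refine (enorm_integral_le_lintegral_enorm _).trans (le_of_eq ?_)
    refine lintegral_congr fun a => ?_
    rw [enorm_mul, Real.enorm_of_nonneg (hk.nonneg a x)]
  rw [lintegral_prod_symm _ ((hk.stronglyMeasurable_integral_mul hX).measurable.enorm.pow_const
    2).aemeasurable]
  rw [← lintegral_const_mul _ (by
    have := hk.stronglyMeasurable_setIntegral univ
    rw [Measure.restrict_univ] at this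
    exact this.measurable.enorm.pow_const 2)]
  refine lintegral_mono fun x => ?_
  have hswap : ∫⁻ ω, (∫⁻ a, ENNReal.ofReal (k a x) * ‖X a ω‖ₑ ^ 2) ∂P
      = ∫⁻ a, ENNReal.ofReal (k a x) * ∫⁻ ω, ‖X a ω‖ₑ ^ 2 ∂P := by
    rw [lintegral_lintegral_swap]
    · refine lintegral_congr fun a => lintegral_const_mul _ ?_
      exact (hX.comp (by fun_prop : Measurable fun ω : Ω => (a, ω))).enorm.pow_const 2
    · refine Measurable.aemeasurable ?_
      exact ((hkm x).comp measurable_snd).ennreal_ofReal.mul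
        ((hX.comp measurable_swap).enorm.pow_const 2)
  have hκ : ENNReal.ofReal (∫ a, k a x) = ‖∫ a, k a x‖ₑ :=
    (Real.enorm_of_nonneg (integral_nonneg fun a => hk.nonneg a x)).symm
  calc ∫⁻ ω, ‖∫ a, k a x * X a ω‖ₑ ^ 2 ∂P
      ≤ ∫⁻ ω, ENNReal.ofReal (∫ a, k a x) *
        (∫⁻ a, ENNReal.ofReal (k a x) * ‖X a ω‖ₑ ^ 2) ∂P :=
        lintegral_mono fun ω => hpt ω x
    _ = ENNReal.ofReal (∫ a, k a x)
        * ∫⁻ a, ENNReal.ofReal (k a x) * ∫⁻ ω, ‖X a ω‖ₑ ^ 2 ∂P := by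
        rw [lintegral_const_mul' _ _ ENNReal.ofReal_ne_top, hswap]
    _ ≤ ENNReal.ofReal (∫ a, k a x) * ∫⁻ a, ENNReal.ofReal (k a x) * δ := by
        gcongr with a
        exact hδ a
    _ = δ * ‖∫ a, k a x‖ₑ ^ 2 := by
        rw [lintegral_mul_const _ (hkm x).ennreal_ofReal, hk.lintegral_eq, hκ]
        ring

theorem eLpNorm_integral_mul_sq_le [SFinite P] [SFinite μ] (hk : IsKernel μ L k)
    {X : ℝ → Ω → ℝ} (hX : Measurable (Function.uncurry X)) {δ : ENNReal}
    (hδ : ∀ a, ∫⁻ ω, ‖X a ω‖ₑ ^ 2 ∂P ≤ δ) :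
    eLpNorm (fun z : Ω × T => ∫ a, k a z.2 * X a z.1) 2 (P.prod μ) ^ 2
      ≤ δ * eLpNorm (fun x => ∫ a, k a x) 2 μ ^ 2 := by
  rw [eLpNorm_two_sq, eLpNorm_two_sq]
  exact hk.lintegral_integral_mul_sq_le hX hδ

theorem memLp_integral_mul [SFinite P] [SFinite μ] (hk : IsKernel μ L k)
    {X : ℝ → Ω → ℝ} (hX : Measurable (Function.uncurry X)) {δ : ENNReal} (hδt : δ ≠ ⊤)
    (hδ : ∀ a, ∫⁻ ω, ‖X a ω‖ₑ ^ 2 ∂P ≤ δ) :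
    MemLp (fun z : Ω × T => ∫ a, k a z.2 * X a z.1) 2 (P.prod μ) := by
  refine ⟨(hk.stronglyMeasurable_integral_mul hX).aestronglyMeasurable, ?_⟩
  have := (hk.eLpNorm_integral_mul_sq_le hX hδ).trans_lt
    (ENNReal.mul_lt_top hδt.lt_top (ENNReal.pow_lt_top hk.memLp_integral.2))
  exact (ENNReal.pow_lt_top_iff.1 this).resolve_right two_ne_zero

theorem ae_integrable_mul [SFinite P] (hk : IsKernel μ L k) {X : ℝ → Ω → ℝ}
    (hX : Measurable (Function.uncurry X)) {δ : ENNReal} (hδt : δ ≠ ⊤)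
    (hδ : ∀ a, ∫⁻ ω, ‖X a ω‖ₑ ∂P ≤ δ) (x : T) :
    ∀ᵐ ω ∂P, Integrable (fun a => k a x * X a ω) := by
  have hkm : Measurable fun a => k a x := hk.measurable.comp (by fun_prop :
    Measurable fun a : ℝ => (a, x))
  have hm : Measurable (fun q : ℝ × Ω => k q.1 x * X q.1 q.2) := (hkm.comp measurable_fst).mul hX
  have hi : Integrable (fun q : ℝ × Ω => k q.1 x * X q.1 q.2) (volume.prod P) := by
    refine ⟨hm.aestronglyMeasurable, ?_⟩
    rw [HasFiniteIntegral, lintegral_prod _ hm.enorm.aemeasurable]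
    calc _ ≤ ∫⁻ a, ENNReal.ofReal (k a x) * δ := by
          refine lintegral_mono fun a => ?_
          simp_rw [enorm_mul, Real.enorm_of_nonneg (hk.nonneg a x)]
          rw [lintegral_const_mul' _ _ ENNReal.ofReal_ne_top]
          gcongr
          exact hδ a
      _ = ENNReal.ofReal (∫ a, k a x) * δ := by
          rw [lintegral_mul_const _ hkm.ennreal_ofReal, hk.lintegral_eq]
      _ < ⊤ := ENNReal.mul_lt_top ENNReal.ofReal_lt_top hδt.lt_top
  exact hi.prod_left_ae

end IsKernel

/-- Rounding down to the dyadic grid of mesh `2⁻ⁿ`. -/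
def dyadicFloor (n : ℕ) (a : ℝ) : ℝ := (⌊a * 2 ^ n⌋ : ℝ) / 2 ^ n

@[fun_prop]
theorem measurable_dyadicFloor (n : ℕ) : Measurable (dyadicFloor n) := by
  unfold dyadicFloor
  have : Measurable fun a : ℝ => ⌊a * 2 ^ n⌋ := by fun_prop
  exact ((measurable_from_top (f := fun i : ℤ => (i : ℝ))).comp this).div_const _

theorem abs_dyadicFloor_sub_le (n : ℕ) (a : ℝ) : |dyadicFloor n a - a| ≤ (1 / 2) ^ n := by
  have h2 : (0 : ℝ) < 2 ^ n := by positivity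
  have h : dyadicFloor n a - a = (⌊a * 2 ^ n⌋ - a * 2 ^ n) / 2 ^ n := by
    rw [dyadicFloor]; field_simp
  rw [h, abs_div, abs_of_pos h2, div_pow, one_pow, div_le_div_iff_of_pos_right h2]
  exact abs_le.2 ⟨by linarith [Int.lt_floor_add_one (a * 2 ^ n)],
    by linarith [Int.floor_le (a * 2 ^ n)]⟩

/-- The dyadic cell of index `i` and mesh `2⁻ⁿ`. -/
def dyadicCell (n : ℕ) (i : ℤ) : Set ℝ := (fun a : ℝ => ⌊a * 2 ^ n⌋) ⁻¹' {i}

theorem measurableSet_dyadicCell (n : ℕ) (i : ℤ) : MeasurableSet (dyadicCell n i) :=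
  (by fun_prop : Measurable fun a : ℝ => ⌊a * 2 ^ n⌋) (measurableSet_singleton i)

namespace IsKernel

variable {L : ℕ} {k : ℝ → T → ℝ}

/-- The indices of the cells of mesh `2⁻ⁿ` in `[0, L)`. -/
def cells (L n : ℕ) : Finset ℤ := Finset.Ico 0 (L * 2 ^ n)

theorem mul_comp_dyadicFloor (hk : IsKernel μ L k) (n : ℕ) (f : ℝ → ℝ) (x : T) (a : ℝ) :
    k a x * f (dyadicFloor n a)
      = ∑ i ∈ cells L n, (dyadicCell n i).indicator (fun a => k a x) a * f (i / 2 ^ n) := by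
  by_cases ha : a ∈ Ico (0 : ℝ) L
  · rw [Finset.sum_eq_single ⌊a * 2 ^ n⌋]
    · rw [indicator_of_mem (by simp [dyadicCell])]; rfl
    · intro i _ hi
      rw [indicator_of_notMem (by simpa [dyadicCell] using hi.symm), zero_mul]
    · intro h
      refine absurd ?_ h
      have h2 : (0 : ℝ) < 2 ^ n := by positivity
      rw [cells, Finset.mem_Ico, Int.floor_lt]
      refine ⟨Int.floor_nonneg.2 (mul_nonneg ha.1 h2.le), ?_⟩
      push_cast
      exact mul_lt_mul_of_pos_right ha.2 h2
  · rw [hk.support a x ha, zero_mul]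
    refine (Finset.sum_eq_zero fun i _ => ?_).symm
    by_cases hi : a ∈ dyadicCell n i
    · rw [indicator_of_mem hi, hk.support a x ha, zero_mul]
    · rw [indicator_of_notMem hi, zero_mul]

theorem integrable_indicator (hk : IsKernel μ L k) (n : ℕ) (i : ℤ) (x : T) :
    Integrable ((dyadicCell n i).indicator (fun a => k a x)) :=
  (hk.integrable x).indicator (measurableSet_dyadicCell n i)

theorem integrable_mul_comp_dyadicFloor (hk : IsKernel μ L k) (n : ℕ) (f : ℝ → ℝ) (x : T) :
    Integrable (fun a => k a x * f (dyadicFloor n a)) := by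
  simp_rw [hk.mul_comp_dyadicFloor]
  exact integrable_finsetSum _ fun i _ => (hk.integrable_indicator n i x).mul_const _

theorem integral_mul_comp_dyadicFloor (hk : IsKernel μ L k) (n : ℕ) (f : ℝ → ℝ) (x : T) :
    ∫ a, k a x * f (dyadicFloor n a)
      = ∑ i ∈ cells L n, f (i / 2 ^ n) * ∫ a in dyadicCell n i, k a x := by
  simp_rw [hk.mul_comp_dyadicFloor]
  rw [integral_finsetSum _ fun i _ => (hk.integrable_indicator n i x).mul_const _]
  refine Finset.sum_congr rfl fun i _ => ?_
  rw [integral_mul_const, integral_indicator (measurableSet_dyadicCell n i), mul_comm]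

theorem setIntegral_nonneg (hk : IsKernel μ L k) (A : Set ℝ) (x : T) : 0 ≤ ∫ a in A, k a x :=
  integral_nonneg fun a => hk.nonneg a x

theorem setIntegral_le (hk : IsKernel μ L k) (A : Set ℝ) (x : T) :
    ∫ a in A, k a x ≤ ∫ a, k a x :=
  setIntegral_le_integral (hk.integrable x) (Eventually.of_forall fun a => hk.nonneg a x)

theorem memLp_setIntegral (hk : IsKernel μ L k) (A : Set ℝ) :
    MemLp (fun x => ∫ a in A, k a x) 2 μ :=
  hk.memLp_integral.mono (hk.stronglyMeasurable_setIntegral A).aestronglyMeasurable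
    (Eventually.of_forall fun x => by
      rw [Real.norm_of_nonneg (hk.setIntegral_nonneg A x),
        Real.norm_of_nonneg (integral_nonneg fun a => hk.nonneg a x)]
      exact hk.setIntegral_le A x)

theorem integrable_setIntegral (hk : IsKernel μ L k) (A : Set ℝ) :
    Integrable (fun x => ∫ a in A, k a x) μ :=
  hk.integrable_integral.mono (hk.stronglyMeasurable_setIntegral A).aestronglyMeasurable
    (Eventually.of_forall fun x => by
      rw [Real.norm_of_nonneg (hk.setIntegral_nonneg A x),
        Real.norm_of_nonneg (integral_nonneg fun a => hk.nonneg a x)]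
      exact hk.setIntegral_le A x)

/-- The mass of the kernel in a dyadic cell, as an element of `L²(μ)`. -/
def cellMass (hk : IsKernel μ L k) (n : ℕ) (i : ℤ) : Lp ℝ 2 μ :=
  (hk.memLp_setIntegral (dyadicCell n i)).toLp _

theorem sum_setIntegral (hk : IsKernel μ L k) (n : ℕ) (x : T) :
    ∑ i ∈ cells L n, ∫ a in dyadicCell n i, k a x = ∫ a, k a x := by
  simpa using (hk.integral_mul_comp_dyadicFloor n (fun _ => 1) x).symm

end IsKernel

end Kernel

/-! ### The divergence of a kernel integral of normalized exponentials -/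

section KernelDivergence

open Filter Topology

variable {Ω T : Type*} [MeasurableSpace Ω] [MeasurableSpace T] {P : Measure Ω} {μ : Measure T}
  {W : Lp ℝ 2 μ → Ω → ℝ}

theorem inner_nonneg_of_ae {f g : Lp ℝ 2 μ} (hf : ∀ᵐ x ∂μ, 0 ≤ f x) (hg : ∀ᵐ x ∂μ, 0 ≤ g x) :
    0 ≤ (inner ℝ f g : ℝ) := by
  rw [inner_Lp]
  refine integral_nonneg_of_ae ?_
  filter_upwards [hf, hg] with x h1 h2 using mul_nonneg h1 h2

theorem inner_le_integral_of_ae {f g : Lp ℝ 2 μ} (hf1 : ∀ᵐ x ∂μ, f x ≤ 1)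
    (hg : ∀ᵐ x ∂μ, 0 ≤ g x) (hgi : Integrable g μ) : (inner ℝ f g : ℝ) ≤ ∫ x, g x ∂μ := by
  rw [inner_Lp]
  refine integral_mono_ae (integrable_mul_of_memLp_two (Lp.memLp f) (Lp.memLp g)) hgi ?_
  filter_upwards [hf1, hg] with x h1 h2
  exact mul_le_of_le_one_left h2 h1

theorem IsIsonormal.integral_sum_wickTerm_sq_le [IsProbabilityMeasure P]
    (hW : IsIsonormal P μ W) {ι : Type*} (I : Finset ι) {c h : ι → Lp ℝ 2 μ} {V : ℝ}
    (hcV : ∀ i, ‖c i‖ ^ 2 ≤ V) (hc0 : ∀ i, ∀ᵐ x ∂μ, 0 ≤ c i x) (hc1 : ∀ i, ∀ᵐ x ∂μ, c i x ≤ 1)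
    (hh : ∀ i, ∀ᵐ x ∂μ, 0 ≤ h i x) (hhi : ∀ i, Integrable (h i) μ) :
    ∫ ω, (∑ i ∈ I, wickTerm P W (c i) (h i) ω) ^ 2 ∂P
      ≤ Real.exp V * (‖∑ i ∈ I, h i‖ ^ 2 + (∑ i ∈ I, ∫ x, h i x ∂μ) ^ 2) := by
  simp_rw [sq, Finset.sum_mul_sum]
  rw [integral_finsetSum _ fun i _ => integrable_finsetSum _ fun j _ =>
    hW.integrable_wickTerm_mul _ _ _ _]
  simp_rw [integral_finsetSum _ fun j _ => hW.integrable_wickTerm_mul _ _ _ _,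
    hW.integral_wickTerm_mul]
  rw [← real_inner_self_eq_norm_mul_norm, sum_inner]
  simp_rw [inner_sum]
  rw [← Finset.sum_add_distrib, Finset.mul_sum]
  refine Finset.sum_le_sum fun i _ => ?_
  rw [← Finset.sum_add_distrib, Finset.mul_sum]
  refine Finset.sum_le_sum fun j _ => ?_
  have hcc : (inner ℝ (c i) (c j) : ℝ) ≤ V := by
    have := real_inner_le_norm (c i) (c j)
    nlinarith [hcV i, hcV j, sq_nonneg (‖c i‖ - ‖c j‖)]
  have h1 := inner_nonneg_of_ae (hh i) (hh j)
  have h2 := inner_nonneg_of_ae (hc0 j) (hh i)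
  have h3 := inner_nonneg_of_ae (hc0 i) (hh j)
  have h4 := inner_le_integral_of_ae (hc1 j) (hh i) (hhi i)
  have h5 := inner_le_integral_of_ae (hc1 i) (hh j) (hhi j)
  gcongr
  exact h2.trans h4

omit [MeasurableSpace Ω] in
theorem measurable_noiseSigma (W : Lp ℝ 2 μ → Ω → ℝ) (h : Lp ℝ 2 μ) :
    Measurable[noiseSigma W] (W h) :=
  Measurable.mono (comap_measurable (W h)) (le_iSup (fun h => MeasurableSpace.comap (W h) _) h)
    le_rfl

theorem measurable_wickTerm_noiseSigma (P : Measure Ω) (W : Lp ℝ 2 μ → Ω → ℝ) (c h : Lp ℝ 2 μ) :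
    Measurable[noiseSigma W] (wickTerm P W c h) := by
  refine Measurable.mul ?_ ((measurable_noiseSigma W h).sub_const _)
  exact (Real.measurable_exp.comp (measurable_noiseSigma W c)).div_const _

variable [IsProbabilityMeasure P] {L : ℕ} {k : ℝ → T → ℝ} {c : ℝ → Lp ℝ 2 μ} {V M : ℝ}

theorem IsField.lintegral_wickExp_sub_sq_le (hW : IsIsonormal P μ W) (hc : IsField c V M)
    (a b : ℝ) : ∫⁻ ω, ‖wickExp P W (c a) ω - wickExp P W (c b) ω‖ₑ ^ 2 ∂P
      ≤ ENNReal.ofReal (2 * Real.exp V * (M * |a - b|)) := by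
  have hδ : 0 ≤ M * |a - b| := mul_nonneg hc.nonneg_lipschitz (abs_nonneg _)
  have h := hW.integral_wickExp_sub_sq_le hδ (hc.norm_sq_le a) (hc.norm_sq_le b)
    (hc.sub_inner_le a b)
    (by rw [real_inner_comm, abs_sub_comm]; exact hc.sub_inner_le b a)
  refine le_trans (le_of_eq ?_) (ENNReal.ofReal_le_ofReal h)
  have hi : Integrable (fun ω => (wickExp P W (c a) ω - wickExp P W (c b) ω) ^ 2) P :=
    ((hW.memLp_wickExp _).sub (hW.memLp_wickExp _)).integrable_sq
  rw [ofReal_integral_eq_lintegral_ofReal hi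
    (Eventually.of_forall fun ω => sq_nonneg _)]
  refine lintegral_congr fun ω => ?_
  rw [← enorm_pow, Real.enorm_of_nonneg (sq_nonneg _)]

theorem IsField.lintegral_wickExp_sq_le (hW : IsIsonormal P μ W) (hc : IsField c V M)
    (a : ℝ) : ∫⁻ ω, ‖wickExp P W (c a) ω‖ₑ ^ 2 ∂P ≤ ENNReal.ofReal (Real.exp V) := by
  have h := hW.integral_wickExp_mul_wickExp (c a) (c a)
  rw [real_inner_self_eq_norm_sq] at h
  refine le_trans (le_of_eq ?_) (ENNReal.ofReal_le_ofReal
    (h.le.trans (Real.exp_le_exp.2 (hc.norm_sq_le a))))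
  rw [ofReal_integral_eq_lintegral_ofReal (hW.integrable_wickExp_mul_wickExp _ _)
    (Eventually.of_forall fun ω => mul_self_nonneg _)]
  refine lintegral_congr fun ω => ?_
  rw [← enorm_pow, Real.enorm_of_nonneg (sq_nonneg _), sq]

theorem IsIsonormal.lintegral_wickExp_le (hW : IsIsonormal P μ W) (c : Lp ℝ 2 μ) :
    ∫⁻ ω, ‖wickExp P W c ω‖ₑ ∂P ≤ 1 := by
  have h := hW.integral_wickExp c
  rw [← ENNReal.ofReal_one, ← h, ofReal_integral_eq_lintegral_ofReal (hW.integrable_wickExp _)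
    (Eventually.of_forall fun ω => (hW.wickExp_pos _ _).le)]
  refine le_of_eq (lintegral_congr fun ω => ?_)
  rw [Real.enorm_of_nonneg (hW.wickExp_pos _ _).le]

theorem IsKernel.ae_integrable_mul_wickExp (hk : IsKernel μ L k) (hW : IsIsonormal P μ W)
    {Q : ℝ → Ω → ℝ} (hQ : Measurable (Function.uncurry Q))
    (hQv : ∀ a, Q a =ᵐ[P] wickExp P W (c a)) (x : T) :
    ∀ᵐ ω ∂P, Integrable (fun a => k a x * Q a ω) := by
  refine hk.ae_integrable_mul hQ ENNReal.one_ne_top (fun a => ?_) x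
  refine le_trans (le_of_eq (lintegral_congr_ae ?_)) (hW.lintegral_wickExp_le (c a))
  filter_upwards [hQv a] with ω hω
  rw [hω]

theorem IsKernel.exists_isDivergence [SFinite μ] (hk : IsKernel μ L k) (hW : IsIsonormal P μ W)
    (hc : IsField c V M) {Q : ℝ → Ω → ℝ} (hQ : Measurable (Function.uncurry Q))
    (hQv : ∀ a, Q a =ᵐ[P] wickExp P W (c a)) :
    ∃ Z, IsDivergence P μ W (fun z => ∫ a, k a z.2 * Q a z.1) Z := by
  have hQ2 : ∀ a, ∫⁻ ω, ‖Q a ω‖ₑ ^ 2 ∂P ≤ ENNReal.ofReal (Real.exp V) := fun a => by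
    refine le_trans (le_of_eq (lintegral_congr_ae ?_)) (hc.lintegral_wickExp_sq_le hW a)
    filter_upwards [hQv a] with ω hω
    rw [hω]
  have hu := hk.memLp_integral_mul hQ ENNReal.ofReal_ne_top hQ2
  have hcm0 : ∀ n i, ∀ᵐ x ∂μ, 0 ≤ hk.cellMass n i x := fun n i => by
    filter_upwards [(hk.memLp_setIntegral (dyadicCell n i)).coeFn_toLp] with x hx
    rw [IsKernel.cellMass, hx]
    exact hk.setIntegral_nonneg _ _
  have hcmi : ∀ n i, Integrable (hk.cellMass n i) μ := fun n i =>
    (hk.integrable_setIntegral _).congr (hk.memLp_setIntegral (dyadicCell n i)).coeFn_toLp.symm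
  set v : ℕ → Ω × T → ℝ := fun n z =>
    ∑ i ∈ IsKernel.cells L n, wickExp P W (c (i / 2 ^ n)) z.1 * hk.cellMass n i z.2 with hv
  have hvm : ∀ n, MemLp (v n) 2 (P.prod μ) := fun n =>
    memLp_finsetSum _ fun i _ => memLp_mul_prod (hW.memLp_wickExp _) (Lp.memLp _)
  have hvae : ∀ n, v n =ᵐ[P.prod μ] fun z => ∫ a, k a z.2 * Q (dyadicFloor n a) z.1 := by
    intro n
    have h1 : ∀ᵐ z ∂(P.prod μ), ∀ i ∈ IsKernel.cells L n,
        Q (i / 2 ^ n) z.1 = wickExp P W (c (i / 2 ^ n)) z.1 := by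
      refine (ae_ball_iff (IsKernel.cells L n).countable_toSet).2 ?_
      exact fun i _ => Measure.quasiMeasurePreserving_fst.ae (hQv _)
    have h2 : ∀ᵐ z ∂(P.prod μ), ∀ i ∈ IsKernel.cells L n,
        hk.cellMass n i z.2 = ∫ a in dyadicCell n i, k a z.2 := by
      refine (ae_ball_iff (IsKernel.cells L n).countable_toSet).2 ?_
      exact fun i _ => Measure.quasiMeasurePreserving_snd.ae
        (hk.memLp_setIntegral (dyadicCell n i)).coeFn_toLp
    filter_upwards [h1, h2] with z hz1 hz2
    rw [hk.integral_mul_comp_dyadicFloor n (fun a => Q a z.1) z.2]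
    exact Finset.sum_congr rfl fun i hi => by rw [hz1 i hi, hz2 i hi]
  have hdiff : ∀ n, v n - (fun z => ∫ a, k a z.2 * Q a z.1) =ᵐ[P.prod μ]
      fun z => ∫ a, k a z.2 * (Q (dyadicFloor n a) z.1 - Q a z.1) := by
    intro n
    have hint : ∀ᵐ z ∂(P.prod μ), Integrable (fun a => k a z.2 * Q a z.1) := by
      have hm : Measurable (fun q : (Ω × T) × ℝ => k q.2 q.1.2 * Q q.2 q.1.1) :=
        (hk.measurable.comp (by fun_prop : Measurable fun q : (Ω × T) × ℝ => (q.2, q.1.2))).mul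
          (hQ.comp (by fun_prop : Measurable fun q : (Ω × T) × ℝ => (q.2, q.1.1)))
      have hms : MeasurableSet {z : Ω × T | Integrable (fun a => k a z.2 * Q a z.1)} :=
        _root_.measurableSet_integrable (f := fun (z : Ω × T) a => k a z.2 * Q a z.1)
          hm.stronglyMeasurable
      rw [Measure.ae_prod_iff_ae_ae hms, Measure.ae_ae_comm hms]
      exact Eventually.of_forall fun x => hk.ae_integrable_mul_wickExp hW hQ hQv x
    filter_upwards [hvae n, hint] with z hz1 hz2
    rw [Pi.sub_apply, hz1, ← integral_sub
      (hk.integrable_mul_comp_dyadicFloor n (fun a => Q a z.1) z.2) hz2]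
    simp_rw [mul_sub]
  refine exists_isDivergence_of_tendsto hW (v := v)
    (Y := fun n ω => ∑ i ∈ IsKernel.cells L n,
      wickTerm P W (c (i / 2 ^ n)) (hk.cellMass n i) ω)
    (C := Real.exp V * (‖hk.memLp_integral.toLp _‖ ^ 2 + (∫ x, (∫ a, k a x) ∂μ) ^ 2))
    hu hvm (fun n => memLp_finsetSum _ fun i _ => hW.memLp_wickTerm _ _) (fun n => ?_)
    (fun n => ?_) (fun n => hW.duality_wickTerm _ _ _) ?_
  · refine StronglyMeasurable.aestronglyMeasurable (Measurable.stronglyMeasurable ?_)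
    exact Finset.measurable_sum _ fun i _ => measurable_wickTerm_noiseSigma P W _ _
  · refine (hW.integral_sum_wickTerm_sq_le _ (fun i : ℤ => hc.norm_sq_le (i / 2 ^ n))
      (fun i : ℤ => hc.nonneg (i / 2 ^ n)) (fun i : ℤ => hc.le_one (i / 2 ^ n)) (hcm0 n)
      (hcmi n)).trans (le_of_eq ?_)
    have e1 : ∑ i ∈ IsKernel.cells L n, hk.cellMass n i = hk.memLp_integral.toLp _ := by
      refine Lp.ext ?_
      have h2 : ∀ᵐ x ∂μ, ∀ i ∈ IsKernel.cells L n,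
          hk.cellMass n i x = ∫ a in dyadicCell n i, k a x :=
        (ae_ball_iff (IsKernel.cells L n).countable_toSet).2 fun i _ =>
          (hk.memLp_setIntegral (dyadicCell n i)).coeFn_toLp
      filter_upwards [h2, hk.memLp_integral.coeFn_toLp,
        Lp.coeFn_finsetSum (IsKernel.cells L n) (hk.cellMass n)] with x h2 h3 h4
      rw [h3, h4, ← hk.sum_setIntegral n, Finset.sum_apply]
      exact Finset.sum_congr rfl h2
    have e2 : ∑ i ∈ IsKernel.cells L n, ∫ x, hk.cellMass n i x ∂μ = ∫ x, (∫ a, k a x) ∂μ := by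
      simp_rw [← hk.sum_setIntegral n]
      rw [integral_finsetSum _ fun i _ => hk.integrable_setIntegral _]
      exact Finset.sum_congr rfl fun i _ =>
        integral_congr_ae (hk.memLp_setIntegral (dyadicCell n i)).coeFn_toLp
    rw [e1, e2]
  · have hb : ∀ n, eLpNorm (v n - fun z => ∫ a, k a z.2 * Q a z.1) 2 (P.prod μ) ^ 2
        ≤ ENNReal.ofReal (2 * Real.exp V * (M * (1 / 2) ^ n))
          * eLpNorm (fun x => ∫ a, k a x) 2 μ ^ 2 := by
      intro n
      rw [eLpNorm_congr_ae (hdiff n)]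
      have hm : Measurable (Function.uncurry fun a ω => Q (dyadicFloor n a) ω - Q a ω) :=
        (hQ.comp (by fun_prop : Measurable fun q : ℝ × Ω => (dyadicFloor n q.1, q.2))).sub hQ
      refine hk.eLpNorm_integral_mul_sq_le hm fun a => ?_
      refine le_trans (le_of_eq (lintegral_congr_ae ?_))
        ((hc.lintegral_wickExp_sub_sq_le hW (dyadicFloor n a) a).trans
          (ENNReal.ofReal_le_ofReal ?_))
      · filter_upwards [hQv a, hQv (dyadicFloor n a)] with ω h1 h2
        rw [h1, h2]
      · have := hc.nonneg_lipschitz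
        gcongr
        exact abs_dyadicFloor_sub_le n a
    have hlim : Tendsto (fun n : ℕ => ENNReal.ofReal (2 * Real.exp V * (M * (1 / 2) ^ n))
        * eLpNorm (fun x => ∫ a, k a x) 2 μ ^ 2) atTop (𝓝 0) := by
      have h1 : Tendsto (fun n : ℕ => 2 * Real.exp V * (M * (1 / 2 : ℝ) ^ n)) atTop (𝓝 0) := by
        have := ((tendsto_pow_atTop_nhds_zero_of_lt_one (r := (1 / 2 : ℝ)) (by norm_num)
          (by norm_num)).const_mul M).const_mul (2 * Real.exp V)
        simpa using this
      have h2 := ENNReal.Tendsto.mul_const (b := eLpNorm (fun x => ∫ a, k a x) 2 μ ^ 2)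
        (ENNReal.tendsto_ofReal h1) (Or.inr (ENNReal.pow_lt_top hk.memLp_integral.2).ne)
      simpa using h2
    have hsq := tendsto_of_tendsto_of_tendsto_of_le_of_le tendsto_const_nhds hlim
      (fun n => zero_le) hb
    have := hsq.ennrpow_const (1 / 2)
    simp_rw [← ENNReal.rpow_two, ← ENNReal.rpow_mul] at this
    norm_num at this
    exact this

end KernelDivergence

/-! ### The cascading noise -/

section Cascade

open Filter Topology

theorem IsField.exists_measurable_version {Ω T : Type*} [MeasurableSpace Ω] [MeasurableSpace T]
    {P : Measure Ω} [IsProbabilityMeasure P] {μ : Measure T} {W : Lp ℝ 2 μ → Ω → ℝ}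
    (hW : IsIsonormal P μ W) {c : ℝ → Lp ℝ 2 μ} {V M : ℝ} (hc : IsField c V M) :
    ∃ Q : ℝ → Ω → ℝ, Measurable (Function.uncurry Q) ∧ ∀ a, Q a =ᵐ[P] wickExp P W (c a) := by
  set R : ℕ → ℝ → Ω → ℝ := fun n a => wickExp P W (c (dyadicFloor n a)) with hR
  have hRm : ∀ n, Measurable (Function.uncurry (R n)) := by
    intro n
    have h1 : Measurable (fun q : ℤ × Ω => wickExp P W (c (q.1 / 2 ^ n)) q.2) :=
      measurable_from_prod_countable_right fun i => hW.measurable_wickExp (c (i / 2 ^ n))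
    exact h1.comp (by fun_prop : Measurable fun q : ℝ × Ω => (⌊q.1 * 2 ^ n⌋, q.2))
  refine ⟨fun a ω => limsup (fun n => R n a ω) atTop, ?_, fun a => ?_⟩
  · exact Measurable.limsup hRm
  · have hdm : ∀ n, Measurable fun ω => ‖R n a ω - wickExp P W (c a) ω‖ₑ ^ 2 := fun n =>
      ((hW.measurable_wickExp _).sub (hW.measurable_wickExp _)).enorm.pow_const 2
    have hsum : ∫⁻ ω, ∑' n, ‖R n a ω - wickExp P W (c a) ω‖ₑ ^ 2 ∂P ≠ ⊤ := by
      rw [lintegral_tsum fun n => (hdm n).aemeasurable]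
      have hM := hc.nonneg_lipschitz
      have hb : ∀ n, ∫⁻ ω, ‖R n a ω - wickExp P W (c a) ω‖ₑ ^ 2 ∂P
          ≤ ENNReal.ofReal (2 * Real.exp V * M * (1 / 2) ^ n) := fun n => by
        refine (hc.lintegral_wickExp_sub_sq_le hW (dyadicFloor n a) a).trans
          (ENNReal.ofReal_le_ofReal ?_)
        rw [← mul_assoc]
        gcongr
        exact abs_dyadicFloor_sub_le n a
      have hs : Summable fun n : ℕ => 2 * Real.exp V * M * (1 / 2 : ℝ) ^ n :=
        (summable_geometric_of_lt_one (by norm_num) (by norm_num)).mul_left _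
      exact ne_top_of_le_ne_top hs.tsum_ofReal_ne_top (ENNReal.tsum_le_tsum hb)
    have hm : Measurable fun ω => ∑' n, ‖R n a ω - wickExp P W (c a) ω‖ₑ ^ 2 :=
      Measurable.tsum hdm
    filter_upwards [ae_lt_top hm hsum] with ω hω
    refine Tendsto.limsup_eq ?_
    have h0 := ENNReal.tendsto_atTop_zero_of_tsum_ne_top hω.ne
    have h1 := h0.ennrpow_const (1 / 2)
    simp_rw [← ENNReal.rpow_two, ← ENNReal.rpow_mul] at h1
    norm_num at h1
    rw [tendsto_iff_edist_tendsto_0]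
    simpa [edist_eq_enorm_sub] using h1

theorem scaleMeasure_Icc_lt_top {c : ℝ} (hc : 0 < c) (J : Set ℝ) {r : ℝ} (hr : 0 < r) :
    scaleMeasure c J (Icc r 1) < ⊤ := by
  rw [scaleMeasure, withDensity_apply _ measurableSet_Icc]
  refine lt_of_le_of_lt (setLIntegral_mono' (g := fun _ => ENNReal.ofReal (c / r ^ 2))
    measurableSet_Icc fun x hx => ?_) ?_
  · apply ENNReal.ofReal_le_ofReal
    have := hx.1
    gcongr
  · rw [setLIntegral_const]
    refine ENNReal.mul_lt_top ENNReal.ofReal_lt_top ?_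
    exact (Measure.restrict_apply_le _ _).trans_lt (by simp)

theorem controlMeasure_le_of_section (c : ℝ) (J : Set ℝ) {A : Set (ℝ × ℝ)}
    (hA : MeasurableSet A) {r δ : ℝ} (hsub : ∀ x ∈ A, x.2 ∈ Icc r 1)
    (hsec : ∀ y ∈ Icc r 1, volume ((fun x : ℝ => (x, y)) ⁻¹' A) ≤ ENNReal.ofReal δ) :
    controlMeasure c J A ≤ ENNReal.ofReal δ * scaleMeasure c J (Icc r 1) := by
  rw [controlMeasure, Measure.prod_apply_symm hA]
  calc _ ≤ ∫⁻ y, (Icc r 1).indicator (fun _ => ENNReal.ofReal δ) y ∂(scaleMeasure c J) := by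
        refine lintegral_mono fun y => ?_
        by_cases hy : y ∈ Icc r 1
        · rw [indicator_of_mem hy]; exact hsec y hy
        · have : (fun x : ℝ => (x, y)) ⁻¹' A = ∅ := by
            ext x
            simp only [mem_preimage, mem_empty_iff_false, iff_false]
            exact fun hx => hy (hsub _ hx)
          simp [this]
    _ = _ := by rw [lintegral_indicator_const measurableSet_Icc]

theorem controlMeasure_cone_le (c : ℝ) (J : Set ℝ) (r a : ℝ) :
    controlMeasure c J (cone r a) ≤ scaleMeasure c J (Icc r 1) := by
  have h := controlMeasure_le_of_section c J (measurableSet_cone r a) (r := r) (δ := 1)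
    (fun x hx => ⟨hx.1, hx.2.1⟩) fun y hy => ?_
  · simpa using h
  · have hs : (fun x : ℝ => (x, y)) ⁻¹' cone r a ⊆ Icc (a - y / 2) (a + y / 2) :=
      fun x hx => ⟨hx.2.2.1, hx.2.2.2⟩
    refine (measure_mono hs).trans ?_
    rw [Real.volume_Icc]
    exact ENNReal.ofReal_le_ofReal (by linarith [hy.2])

theorem controlMeasure_cone_diff_le (c : ℝ) (J : Set ℝ) (r a b : ℝ) :
    controlMeasure c J (cone r a \ cone r b)
      ≤ ENNReal.ofReal |a - b| * scaleMeasure c J (Icc r 1) := by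
  refine controlMeasure_le_of_section c J
    ((measurableSet_cone r a).diff (measurableSet_cone r b))
    (fun x hx => ⟨hx.1.1, hx.1.2.1⟩) fun y hy => ?_
  rcases le_total a b with hab | hab
  · have hs : (fun x : ℝ => (x, y)) ⁻¹' (cone r a \ cone r b) ⊆ Ico (a - y / 2) (b - y / 2) := by
      rintro x ⟨⟨-, -, h1, h2⟩, h3⟩
      refine ⟨h1, ?_⟩
      by_contra! h4
      exact h3 ⟨hy.1, hy.2, h4, by simp only at h2 ⊢; linarith⟩
    refine (measure_mono hs).trans ?_
    rw [Real.volume_Ico]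
    exact ENNReal.ofReal_le_ofReal (by rw [abs_sub_comm]; linarith [le_abs_self (b - a)])
  · have hs : (fun x : ℝ => (x, y)) ⁻¹' (cone r a \ cone r b) ⊆ Ioc (b + y / 2) (a + y / 2) := by
      rintro x ⟨⟨-, -, h1, h2⟩, h3⟩
      refine ⟨?_, h2⟩
      by_contra! h4
      exact h3 ⟨hy.1, hy.2, by simp only at h1 ⊢; linarith, h4⟩
    refine (measure_mono hs).trans ?_
    rw [Real.volume_Ioc]
    exact ENNReal.ofReal_le_ofReal (by linarith [le_abs_self (a - b)])

/-- The indicator function of the cone at `a`, as an element of `L²`. -/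
def coneIndicator {c : ℝ} (hc : 0 < c) (J : Set ℝ) {r : ℝ} (hr : 0 < r) (a : ℝ) :
    Lp ℝ 2 (controlMeasure c J) :=
  indicatorConstLp 2 (measurableSet_cone r a) (controlMeasure_cone_ne_top hc J hr a) 1

theorem inner_coneIndicator {c : ℝ} (hc : 0 < c) (J : Set ℝ) {r : ℝ} (hr : 0 < r) (a b : ℝ) :
    inner ℝ (coneIndicator hc J hr a) (coneIndicator hc J hr b)
      = (controlMeasure c J).real (cone r a ∩ cone r b) := by
  rw [inner_Lp, ← integral_indicator_one ((measurableSet_cone r a).inter (measurableSet_cone r b))]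
  refine integral_congr_ae ?_
  filter_upwards [indicatorConstLp_coeFn (p := 2) (hs := measurableSet_cone r a)
    (hμs := controlMeasure_cone_ne_top hc J hr a) (c := (1 : ℝ)),
    indicatorConstLp_coeFn (p := 2) (hs := measurableSet_cone r b)
    (hμs := controlMeasure_cone_ne_top hc J hr b) (c := (1 : ℝ))] with x h1 h2
  rw [coneIndicator, coneIndicator, h1, h2, inter_indicator_one]
  rfl

theorem isField_coneIndicator {c : ℝ} (hc : 0 < c) (J : Set ℝ) {r : ℝ} (hr : 0 < r) :
    IsField (coneIndicator hc J hr) ((scaleMeasure c J).real (Icc r 1))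
      ((scaleMeasure c J).real (Icc r 1)) := by
  have hae : ∀ a, coneIndicator hc J hr a =ᵐ[controlMeasure c J]
      (cone r a).indicator fun _ => 1 := fun a => indicatorConstLp_coeFn
  have htop := (scaleMeasure_Icc_lt_top hc J hr).ne
  refine ⟨fun a => ?_, fun a => ?_, fun a => ?_, fun a b => ?_⟩
  · filter_upwards [hae a] with x hx
    rw [hx]
    exact indicator_nonneg (fun _ _ => zero_le_one) x
  · filter_upwards [hae a] with x hx
    rw [hx]
    exact indicator_le_self' (fun _ _ => zero_le_one) x
  · rw [← real_inner_self_eq_norm_sq, inner_coneIndicator, inter_self]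
    exact ENNReal.toReal_mono htop (controlMeasure_cone_le c J r a)
  · rw [← real_inner_self_eq_norm_sq, inner_coneIndicator, inner_coneIndicator, inter_self]
    have h1 := measureReal_sdiff_add_inter (μ := controlMeasure c J) (s := cone r a)
      (measurableSet_cone r b) (controlMeasure_cone_ne_top hc J hr a)
    have h2 := ENNReal.toReal_mono (ENNReal.mul_ne_top ENNReal.ofReal_ne_top htop)
      (controlMeasure_cone_diff_le c J r a b)
    rw [ENNReal.toReal_mul, ENNReal.toReal_ofReal (abs_nonneg _)] at h2
    simp only [measureReal_def] at h1 ⊢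
    linarith

end Cascade

/-! ### The fractional kernel -/

section FractionalKernel

open Filter Topology

/-- The set of all `(a, s)` with `0 < s < a < t`. -/
def fbmDomain (t : ℝ) : Set (ℝ × ℝ) := {q | 0 < q.2 ∧ q.2 < q.1 ∧ q.1 < t}

/-- The kernel `1_{A₂}(r') 1_{0 < s < a < t} ∂₁K(a, s)`. -/
def fbmIntegralKernel (H : ℝ) (A₂ : Set ℝ) (t a : ℝ) (x : ℝ × ℝ) : ℝ :=
  A₂.indicator 1 x.2 * (fbmDomain t).indicator
    (fun q => fbmConst H * (q.2 / q.1) ^ (1 / 2 - H) * (q.1 - q.2) ^ (H - 3 / 2)) (a, x.1)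

theorem fbmIntegralKernel_mul_eq {H : ℝ} (hH : 1 / 2 < H) (A₂ : Set ℝ) (t a : ℝ) {x : ℝ × ℝ}
    (hx : 0 < x.1) : fbmIntegralKernel H A₂ t a x
      = A₂.indicator 1 x.2 * (Ioo x.1 t).indicator (fun a => fbmKernelDeriv H a x.1) a := by
  rw [fbmIntegralKernel]
  congr 1
  by_cases ha : a ∈ Ioo x.1 t
  · rw [indicator_of_mem ha, indicator_of_mem
      (show (a, x.1) ∈ fbmDomain t from ⟨hx, ha.1, ha.2⟩), fbmKernelDeriv_eq hH hx ha.1]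
  · rw [indicator_of_notMem ha, indicator_of_notMem fun h => ha ⟨h.2.1, h.2.2⟩]

theorem measurable_fbmIntegralKernel (H : ℝ) {A₂ : Set ℝ} (hA₂ : MeasurableSet A₂) (t : ℝ) :
    Measurable (Function.uncurry (fbmIntegralKernel H A₂ t)) := by
  have hS : MeasurableSet (fbmDomain t) := by
    unfold fbmDomain
    measurability
  have h1 : Measurable ((fbmDomain t).indicator
      (fun q => fbmConst H * (q.2 / q.1) ^ (1 / 2 - H) * (q.1 - q.2) ^ (H - 3 / 2))) :=
    Measurable.indicator (by fun_prop) hS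
  have h2 : Measurable (A₂.indicator (1 : ℝ → ℝ)) := measurable_one.indicator hA₂
  exact (h2.comp (by fun_prop : Measurable fun p : ℝ × (ℝ × ℝ) => p.2.2)).mul
    (h1.comp (by fun_prop : Measurable fun p : ℝ × (ℝ × ℝ) => (p.1, p.2.1)))

theorem fbmIntegralKernel_nonneg (H : ℝ) (A₂ : Set ℝ) (t a : ℝ) (x : ℝ × ℝ) :
    0 ≤ fbmIntegralKernel H A₂ t a x := by
  refine mul_nonneg (indicator_nonneg (fun _ _ => zero_le_one) _)
    (indicator_nonneg (fun q hq => ?_) _)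
  have h1 : 0 < q.1 := hq.1.trans hq.2.1
  have h2 : 0 < q.2 := hq.1
  have h3 : 0 ≤ q.1 - q.2 := (sub_pos.2 hq.2.1).le
  have h4 : 0 ≤ fbmConst H := Real.sqrt_nonneg _
  positivity

/-- A majorant of the integral of the kernel, as a function of `s`. -/
def fbmMajorant (H t s : ℝ) : ℝ :=
  (Ioo 0 t).indicator (fun s => fbmConst H * t ^ (H - 1 / 2) * (t ^ (H - 1 / 2) / (H - 1 / 2))
    * s ^ (1 / 2 - H)) s

theorem integrable_fbmIntegralKernel {H : ℝ} (hH : 1 / 2 < H) {A₂ : Set ℝ}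
    (hA₂ : MeasurableSet A₂) (t : ℝ) (x : ℝ × ℝ) :
    Integrable (fun a => fbmIntegralKernel H A₂ t a x) ∧
      ∫ a, fbmIntegralKernel H A₂ t a x ≤ fbmMajorant H t x.1 * A₂.indicator 1 x.2 := by
  obtain ⟨s, y⟩ := x
  have hm : Measurable (fun a => fbmIntegralKernel H A₂ t a (s, y)) :=
    (measurable_fbmIntegralKernel H hA₂ t).comp (by fun_prop : Measurable fun a : ℝ => (a, (s, y)))
  by_cases hs : s ∈ Ioo 0 t
  swap
  · have h0 : ∀ a, fbmIntegralKernel H A₂ t a (s, y) = 0 := fun a => by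
      rw [fbmIntegralKernel, indicator_of_notMem (s := fbmDomain t), mul_zero]
      exact fun h => hs ⟨h.1, h.2.1.trans h.2.2⟩
    simp_rw [h0, fbmMajorant, indicator_of_notMem hs]
    simp
  obtain ⟨hs0, hst⟩ := hs
  have ht : 0 < t := hs0.trans hst
  have hc : 0 ≤ fbmConst H := Real.sqrt_nonneg _
  set i : ℝ := A₂.indicator 1 y with hi
  have hi0 : 0 ≤ i := indicator_nonneg (fun _ _ => zero_le_one) y
  set C : ℝ := i * (fbmConst H * (s ^ (1 / 2 - H) * t ^ (H - 1 / 2))) with hC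
  have hC0 : 0 ≤ C := by positivity
  have hint : IntervalIntegrable (fun a : ℝ => (a - s) ^ (H - 3 / 2)) volume s t := by
    have h := (intervalIntegral.intervalIntegrable_rpow' (a := 0) (b := t - s)
      (r := H - 3 / 2) (by linarith)).comp_sub_right s
    simpa using h
  have hbi : Integrable ((Ioc s t).indicator fun a => C * (a - s) ^ (H - 3 / 2)) := by
    rw [integrable_indicator_iff measurableSet_Ioc]
    exact ((intervalIntegrable_iff_integrableOn_Ioc_of_le hst.le).1 hint).const_mul C
  have hle : ∀ a, fbmIntegralKernel H A₂ t a (s, y)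
      ≤ (Ioc s t).indicator (fun a => C * (a - s) ^ (H - 3 / 2)) a := by
    intro a
    by_cases ha : s < a ∧ a < t
    · have ha0 : 0 < a := hs0.trans ha.1
      rw [fbmIntegralKernel, indicator_of_mem
        (show (a, s) ∈ fbmDomain t from ⟨hs0, ha.1, ha.2⟩),
        indicator_of_mem (show a ∈ Ioc s t from ⟨ha.1, ha.2.le⟩), hC, mul_assoc i]
      have h1 : (s / a) ^ (1 / 2 - H) ≤ s ^ (1 / 2 - H) * t ^ (H - 1 / 2) := by
        rw [Real.div_rpow hs0.le ha0.le, div_eq_mul_inv, ← Real.rpow_neg ha0.le, neg_sub]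
        have := Real.rpow_le_rpow ha0.le ha.2.le (by linarith : 0 ≤ H - 1 / 2)
        gcongr
      have h2 : 0 ≤ (a - s) ^ (H - 3 / 2) := Real.rpow_nonneg (sub_pos.2 ha.1).le _
      gcongr
    · rw [fbmIntegralKernel, indicator_of_notMem (s := fbmDomain t) fun h => ha h.2, mul_zero]
      refine indicator_nonneg (fun a ha => ?_) a
      have h2 : 0 ≤ (a - s) ^ (H - 3 / 2) := Real.rpow_nonneg (sub_pos.2 ha.1).le _
      positivity
  have hki : Integrable (fun a => fbmIntegralKernel H A₂ t a (s, y)) :=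
    hbi.mono' hm.aestronglyMeasurable (Eventually.of_forall fun a => by
      rw [Real.norm_of_nonneg (fbmIntegralKernel_nonneg H A₂ t a _)]
      exact hle a)
  refine ⟨hki, (integral_mono hki hbi hle).trans ?_⟩
  rw [integral_indicator measurableSet_Ioc, ← intervalIntegral.integral_of_le hst.le,
    intervalIntegral.integral_const_mul, intervalIntegral.integral_comp_sub_right
      (fun a => a ^ (H - 3 / 2)), sub_self, integral_rpow (Or.inl (by linarith)),
    fbmMajorant, indicator_of_mem (show (s, y).1 ∈ Ioo 0 t from ⟨hs0, hst⟩)]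
  have e1 : H - 3 / 2 + 1 = H - 1 / 2 := by ring
  rw [e1, Real.zero_rpow (by linarith), sub_zero]
  have h1 : (t - s) ^ (H - 1 / 2) ≤ t ^ (H - 1 / 2) :=
    Real.rpow_le_rpow (sub_pos.2 hst).le (by linarith) (by linarith)
  have hH' : 0 < H - 1 / 2 := by linarith
  calc C * ((t - s) ^ (H - 1 / 2) / (H - 1 / 2)) ≤ C * (t ^ (H - 1 / 2) / (H - 1 / 2)) := by gcongr
    _ = _ := by simp only [hC]; ring

theorem memLp_fbmMajorant {H : ℝ} (hH1 : H < 1) (t : ℝ) :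
    Integrable (fbmMajorant H t) ∧ MemLp (fbmMajorant H t) 2 := by
  rcases le_or_gt t 0 with ht | ht
  · have : fbmMajorant H t = 0 := by
      ext s; rw [fbmMajorant, Ioo_eq_empty (by linarith), indicator_empty]; rfl
    rw [this]
    exact ⟨integrable_zero _ _ _, MemLp.zero⟩
  have hpow : ∀ p : ℝ, -1 < p → IntegrableOn (fun s : ℝ => s ^ p) (Ioo 0 t) := fun p hp =>
    ((intervalIntegrable_iff_integrableOn_Ioo_of_le ht.le).1
      (intervalIntegral.intervalIntegrable_rpow' hp))
  have hm : Measurable (fbmMajorant H t) :=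
    Measurable.indicator (by fun_prop) measurableSet_Ioo
  constructor
  · refine (integrable_indicator_iff measurableSet_Ioo).2 ?_
    exact (hpow _ (by linarith)).const_mul _
  · rw [memLp_two_iff_integrable_sq hm.aestronglyMeasurable]
    have e : (fun s => fbmMajorant H t s ^ 2) = (Ioo 0 t).indicator (fun s =>
        (fbmConst H * t ^ (H - 1 / 2) * (t ^ (H - 1 / 2) / (H - 1 / 2))) ^ 2
          * s ^ (1 - 2 * H)) := by
      ext s
      by_cases hs : s ∈ Ioo 0 t
      · rw [fbmMajorant, indicator_of_mem hs, indicator_of_mem hs, mul_pow _ (s ^ _),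
          ← Real.rpow_mul_natCast hs.1.le]
        congr 2
        push_cast
        ring
      · rw [fbmMajorant, indicator_of_notMem hs, indicator_of_notMem hs, zero_pow two_ne_zero]
    rw [e]
    refine (integrable_indicator_iff measurableSet_Ioo).2 ?_
    exact (hpow _ (by linarith)).const_mul _

theorem isKernel_fbmIntegralKernel {c : ℝ} {J A₂ : Set ℝ} (hA₂ : MeasurableSet A₂)
    (hA₂1 : scaleMeasure c J A₂ ≠ ⊤) {H : ℝ} (hH : 1 / 2 < H) (hH1 : H < 1) (t : ℝ) :
    IsKernel (controlMeasure c J) ⌈t⌉₊ (fbmIntegralKernel H A₂ t) := by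
  have hm := measurable_fbmIntegralKernel H hA₂ t
  have hmi : AEStronglyMeasurable (fun x => ∫ a, fbmIntegralKernel H A₂ t a x)
      (controlMeasure c J) := by
    have h : Measurable (Function.uncurry fun x a => fbmIntegralKernel H A₂ t a x) :=
      hm.comp measurable_swap
    exact h.stronglyMeasurable.integral_prod_right.aestronglyMeasurable
  have hle : ∀ x, ‖∫ a, fbmIntegralKernel H A₂ t a x‖ ≤ fbmMajorant H t x.1 * A₂.indicator 1 x.2 :=
    fun x => by
      rw [Real.norm_of_nonneg (integral_nonneg fun a => fbmIntegralKernel_nonneg H A₂ t a x)]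
      exact (integrable_fbmIntegralKernel hH hA₂ t x).2
  have hA2 : MemLp (A₂.indicator (1 : ℝ → ℝ)) 2 (scaleMeasure c J) :=
    memLp_indicator_const 2 hA₂ 1 (Or.inr hA₂1)
  have hA1 : Integrable (A₂.indicator (1 : ℝ → ℝ)) (scaleMeasure c J) :=
    (integrable_indicator_iff hA₂).2 (integrableOn_const hA₂1)
  obtain ⟨h1, h2⟩ := memLp_fbmMajorant hH1 t
  refine ⟨hm, fbmIntegralKernel_nonneg H A₂ t, fun a x ha => ?_,
    fun x => (integrable_fbmIntegralKernel hH hA₂ t x).1, ?_, ?_⟩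
  · rw [fbmIntegralKernel, indicator_of_notMem (s := fbmDomain t), mul_zero]
    exact fun h => ha ⟨(h.1.trans h.2.1).le, h.2.2.trans_le (Nat.le_ceil t)⟩
  · exact (h1.mul_prod hA1).mono' hmi (Eventually.of_forall hle)
  · exact MemLp.mono' (memLp_mul_prod h2 hA2) hmi (Eventually.of_forall hle)

variable {Ω : Type*}

theorem integral_fbmIntegralKernel_mul {H : ℝ} (hH : 1 / 2 < H) (A₂ : Set ℝ) {t : ℝ}
    (X : ℝ → Ω → ℝ) (z : Ω × (ℝ × ℝ)) (hz : z.2.1 ≠ 0) :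
    fbmIntegrand H A₂ t X z = ∫ a, fbmIntegralKernel H A₂ t a z.2 * X a z.1 := by
  obtain ⟨ω, s, y⟩ := z
  simp only at hz
  by_cases hs : s ∈ Icc 0 t
  · have hs0 : 0 < s := lt_of_le_of_ne hs.1 (Ne.symm hz)
    simp_rw [fbmIntegralKernel_mul_eq hH A₂ t _ (x := (s, y)) hs0, mul_assoc]
    rw [integral_const_mul, fbmIntegrand, indicator_of_mem hs, Pi.one_apply, one_mul]
    congr 1
    rw [kernelTransfer, intervalIntegral.integral_of_le hs.2, integral_Ioc_eq_integral_Ioo,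
      ← integral_indicator measurableSet_Ioo]
    refine integral_congr_ae (Eventually.of_forall fun a => ?_)
    simp only
    rw [indicator_mul_left]
  · have h0 : ∀ a, fbmIntegralKernel H A₂ t a (s, y) = 0 := fun a => by
      rw [fbmIntegralKernel, indicator_of_notMem (s := fbmDomain t), mul_zero]
      exact fun h => hs ⟨h.1.le, (h.2.1.trans h.2.2).le⟩
    simp [fbmIntegrand, h0, indicator_of_notMem hs]

theorem fbmIntegrand_ae_eq [MeasurableSpace Ω] (P : Measure Ω) [SFinite P] {c : ℝ} {J : Set ℝ}
    {H : ℝ} (hH : 1 / 2 < H) (A₂ : Set ℝ) (t : ℝ) (X : ℝ → Ω → ℝ) :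
    fbmIntegrand H A₂ t X =ᵐ[P.prod (controlMeasure c J)]
      fun z => ∫ a, fbmIntegralKernel H A₂ t a z.2 * X a z.1 := by
  have h0 : ∀ᵐ s : ℝ, s ≠ 0 := by simp [ae_iff]
  have h1 : ∀ᵐ x ∂(controlMeasure c J), x.1 ≠ 0 := Measure.quasiMeasurePreserving_fst.ae h0
  have h2 : ∀ᵐ z ∂(P.prod (controlMeasure c J)), z.2.1 ≠ 0 :=
    Measure.quasiMeasurePreserving_snd.ae h1
  filter_upwards [h2] with z hz using integral_fbmIntegralKernel_mul hH A₂ X z hz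

theorem integral_mul_ae_eq_of_version [MeasurableSpace Ω] {P : Measure Ω} [SFinite P]
    {T : Type*} [MeasurableSpace T] {μ : Measure T} [SFinite μ] (k : ℝ → T → ℝ)
    {X Y : ℝ → Ω → ℝ} (hX : Measurable (Function.uncurry X)) (hY : Measurable (Function.uncurry Y))
    (h : ∀ a, X a =ᵐ[P] Y a) :
    (fun z : Ω × T => ∫ a, k a z.2 * X a z.1) =ᵐ[P.prod μ] fun z => ∫ a, k a z.2 * Y a z.1 := by
  have hms : MeasurableSet {q : ℝ × Ω | X q.1 q.2 = Y q.1 q.2} := measurableSet_eq_fun hX hY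
  have h1 : ∀ᵐ ω ∂P, ∀ᵐ a, X a ω = Y a ω :=
    (Measure.ae_ae_comm (p := fun a ω => X a ω = Y a ω) hms).1 (Eventually.of_forall h)
  filter_upwards [Measure.quasiMeasurePreserving_fst.ae h1] with z hz
  refine integral_congr_ae ?_
  filter_upwards [hz] with a ha
  rw [ha]

end FractionalKernel

end FracMRW

end

theorem proposition2
    {Ω : Type*} [MeasurableSpace Ω] (P : Measure Ω) [IsProbabilityMeasure P]
    -- the control measure, either on all scales in `(0, ∞)` or cut off at the scale `1`
    (c : ℝ) (hc : 0 < c) (J : Set ℝ) (hJ : J = Ioi 0 ∨ J = Ioc 0 1)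
    -- the isonormal noise
    (W : Lp ℝ 2 (controlMeasure c J) → Ω → ℝ) (hW : IsIsonormal P (controlMeasure c J) W)
    (A₂ : Set ℝ) (hA₂ : MeasurableSet A₂) (hA₂1 : scaleMeasure c J A₂ = 1)
    (H : ℝ) (hH : 1 / 2 < H) (hH1 : H < 1)
    (r : ℝ) (hr : 0 < r) (t : ℝ) (ht : 0 ≤ t) :
    -- the cascading noise has a jointly measurable version
    (∃ Q : ℝ → Ω → ℝ, IsCascadeNoise P hc W hr Q) ∧
    -- for every such version the inner integral converges absolutely almost surely, and the
    -- integrand belongs to the domain of the divergence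
    (∀ Q : ℝ → Ω → ℝ, IsCascadeNoise P hc W hr Q →
      (∀ s ∈ Ioo 0 t, ∀ᵐ ω ∂P,
        IntervalIntegrable (fun a => fbmKernelDeriv H a s * Q a ω) volume s t) ∧
      InDomDivergence P (controlMeasure c J) W (fbmIntegrand H A₂ t Q)) ∧
    -- the Skorohod integral exists, is unique almost surely, and does not depend on the version
    (∃ Z : Ω → ℝ, ∀ Q : ℝ → Ω → ℝ, IsCascadeNoise P hc W hr Q →
      ∀ Z' : Ω → ℝ, IsFBMSkorohodIntegral P W A₂ H t Q Z' ↔ Z' =ᵐ[P] Z) := by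
  have hfield := isField_coneIndicator hc J hr
  have hkernel := isKernel_fbmIntegralKernel (c := c) (J := J) hA₂ (by simp [hA₂1]) hH hH1 t
  obtain ⟨Q₀, hQ₀m, hQ₀v⟩ := hfield.exists_measurable_version hW
  obtain ⟨Z, hZ⟩ := hkernel.exists_isDivergence hW hfield hQ₀m hQ₀v
  have hdiv : ∀ Q : ℝ → Ω → ℝ, IsCascadeNoise P hc W hr Q →
      IsFBMSkorohodIntegral P W A₂ H t Q Z := by
    intro Q hQ
    refine hZ.congr ?_ Filter.EventuallyEq.rfl
    refine Filter.EventuallyEq.trans ?_ (fbmIntegrand_ae_eq P hH A₂ t Q).symm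
    exact integral_mul_ae_eq_of_version _ hQ₀m hQ.measurable fun a =>
      (hQ₀v a).trans (hQ.version a).symm
  refine ⟨⟨Q₀, hQ₀m, hQ₀v⟩, fun Q hQ => ⟨fun s hs => ?_, (hdiv Q hQ).mem_dom⟩,
    Z, fun Q hQ Z' => ⟨fun h => h.ae_eq hW (hdiv Q hQ),
      fun h => (hdiv Q hQ).congr Filter.EventuallyEq.rfl h.symm⟩⟩
  obtain ⟨y, hy⟩ : A₂.Nonempty := by
    rw [nonempty_iff_ne_empty]
    rintro rfl
    simp at hA₂1
  filter_upwards [hkernel.ae_integrable_mul_wickExp hW hQ.measurable hQ.version (s, y)] with ω hω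
  rw [intervalIntegrable_iff_integrableOn_Ioo_of_le hs.2.le,
    ← integrable_indicator_iff measurableSet_Ioo]
  refine hω.congr (Filter.Eventually.of_forall fun a => ?_)
  simp only
  rw [fbmIntegralKernel_mul_eq hH A₂ t a (x := (s, y)) hs.1, indicator_of_mem hy, Pi.one_apply,
    one_mul, indicator_mul_left]
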